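/- Let $N\ge 1$ be an integer, $h$ any integer with $N-2h\ne -1$, and $x>0$ real. Put $$a_{j}=\cos\Big(\frac{\pi j}{2N}\Big),\quad b_{j}=\sin\Big(\frac{\pi j}{2N}\Big),\quad A(y)=\pi(2\pi y)^{1/N},\quad s_0=\frac{N-2h+1}{N},$$ $$f_0(n)=\frac{e^{-A(n/x)}}{2\sinh A(n/x)},\qquad f_j(n)=\frac{\cos\big(2A(\frac nx)b_{j}+\frac{\pi(2h-1)j}{2N}\big)-e^{-2A(n/x)a_{j}}\cos\big(\frac{\pi(2h-1)j}{2N}\big)}{\cosh\big(2A(\frac nx)a_{j}\big)-\cos\big(2A(\frac nx)b_{j}\big)}\quad(j\ge1).$$ Define $$P(x)=-\tfrac12\zeta(2h-N)+\frac{\zeta(2h)}{x}+\frac1N\,\Gamma(s_0)\zeta(s_0)\,x^{-s_0},$$ where $\Gamma(s_0)\zeta(s_0)$ denotes the value at $s_0$ of the meromorphic function $\Gamma(s)\zeta(s)$, i.e. $\lim_{s\to s_0}\Gamma(s)\zeta(s)$ (this matters only when $s_0\in\{-2,-4,\dots\}$, where the pole of $\Gamma$ is cancelled by the zero of $\zeta$).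 With the Bernoulli numbers $B_m$ given by $\frac{t}{e^t-1}=\sum_{m\ge0}B_m\frac{t^m}{m!}$, define $$P_1(x)=P(x)+(-1)^{h+1}2^{2h-1}\pi^{2h}\sum_{j=1}^{\lfloor h/N\rfloor}\Big(\frac{-1}{4\pi^2}\Big)^{jN}\frac{B_{2j}B_{2h-2jN}\,x^{2j-1}}{(2j)!\,(2h-2jN)!},$$ where the sum is empty if $\lfloor h/N\rfloor\le 0$, and $$S(x)=\frac{(-1)^{h+1}}{N}\Big(\frac{2\pi}{x}\Big)^{s_0}\sum_{n=1}^\infty \frac{F(n)}{n^{(2h-1)/N}},\qquad F(n)=\begin{cases}f_0(n)+\sum_{j=1}^{(N-1)/2}f_{2j}(n), & N\text{ odd},\\[2pt] \sum_{j=1}^{N/2}f_{2j-1}(n), & N\text{ even}.\end{cases}$$ Then the limit defining $\Gamma(s_0)\zeta(s_0)$ exists and is finite, both infinite series below converge absolutely, and $$\sum_{n=1}^\infty\frac{n^{N-2h}}{e^{n^Nx}-1}=P_1(x)+S(x).$$ -/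

import Mathlib

open Filter Topology

noncomputable section

namespace KTY

/-- `a_{j,N} = cos (π j / (2N))`. -/
def a (j N : ℕ) : ℝ := Real.cos (Real.pi * j / (2 * N))

/-- `b_{j,N} = sin (π j / (2N))`. -/
def b (j N : ℕ) : ℝ := Real.sin (Real.pi * j / (2 * N))

/-- `A_N(y) = π (2 π y)^{1/N}`. -/
def A (N : ℕ) (y : ℝ) : ℝ := Real.pi * (2 * Real.pi * y) ^ (1 / (N : ℝ))

/-- `f₀(x; n, N)`. -/
def f₀ (x : ℝ) (n N : ℕ) : ℝ :=
  Real.exp (-A N (n / x)) / (2 * Real.sinh (A N (n / x)))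

/-- `f_j(x; n, N, h)` for `j ≥ 1`. -/
def f (j : ℕ) (x : ℝ) (n N : ℕ) (h : ℤ) : ℝ :=
  (Real.cos (2 * A N (n / x) * b j N + Real.pi * (2 * h - 1) * j / (2 * N))
      - Real.exp (-2 * A N (n / x) * a j N) * Real.cos (Real.pi * (2 * h - 1) * j / (2 * N)))
    / (Real.cosh (2 * A N (n / x) * a j N) - Real.cos (2 * A N (n / x) * b j N))

/-- The exponent `s₀ = (N - 2h + 1) / N`. -/
def s₀ (N : ℕ) (h : ℤ) : ℝ := ((N : ℝ) - 2 * h + 1) / N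

/-- The value at `s` of the meromorphic function `Γ(s) ζ(s)`. It is taken as the limit at `s`, since
at `s = -2, -4, …` the pole of `Γ` is cancelled by the zero of `ζ`, and the product has a finite
nonzero value there. Wherever `Γ` and `ζ` are both regular this is the product of their values. -/
def gammaZeta (s : ℂ) : ℂ :=
  limUnder (𝓝[≠] s) (fun z : ℂ => Complex.Gamma z * riemannZeta z)

/-- `P(x; N, h)`. -/
def P (x : ℝ) (N : ℕ) (h : ℤ) : ℂ :=
  -(1 / 2) * riemannZeta (-(N : ℂ) + 2 * (h : ℂ)) + riemannZeta (2 * (h : ℂ)) / (x : ℂ)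
    + 1 / (N : ℂ) * gammaZeta (s₀ N h : ℂ) * ((x ^ (-s₀ N h) : ℝ) : ℂ)

/-- The `j`-th Bernoulli term of the extra finite sum; it is used for `1 ≤ j ≤ ⌊h/N⌋` only, where
`2h - 2jN ≥ 0` and `2j - 1 ≥ 1`. -/
def bernoulliTerm (x : ℝ) (N : ℕ) (h : ℤ) (j : ℕ) : ℝ :=
  (-1 / (4 * Real.pi ^ 2)) ^ (j * N)
    * ((bernoulli (2 * j) : ℝ) * (bernoulli (2 * h - 2 * j * N).toNat : ℝ) * x ^ (2 * j - 1))
    / ((Nat.factorial (2 * j) : ℝ) * (Nat.factorial (2 * h - 2 * j * N).toNat : ℝ))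

/-- `P₁(x; N, h)`. The natural-number floor is `0` for negative `h`, so the sum is then empty. -/
def P₁ (x : ℝ) (N : ℕ) (h : ℤ) : ℂ :=
  P x N h +
    (((-1) ^ (h + 1) * 2 ^ (2 * h - 1) * Real.pi ^ (2 * h)
      * ∑ j ∈ Finset.Icc 1 ⌊(h : ℝ) / N⌋₊, bernoulliTerm x N h j : ℝ) : ℂ)

/-- The `n`-th term of the series in `S(x; N, h)`, for `n ≥ 1`. -/
def sTerm (x : ℝ) (N : ℕ) (h : ℤ) (n : ℕ) : ℝ :=
  1 / (n : ℝ) ^ ((2 * (h : ℝ) - 1) / N) *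
    if Odd N then f₀ x n N + ∑ j ∈ Finset.Icc 1 ((N - 1) / 2), f (2 * j) x n N h
    else ∑ j ∈ Finset.Icc 1 (N / 2), f (2 * j - 1) x n N h

/-- `S(x; N, h)`. -/
def S (x : ℝ) (N : ℕ) (h : ℤ) : ℝ :=
  (-1) ^ (h + 1) / N * (2 * Real.pi / x) ^ (s₀ N h) * ∑' n : ℕ, sTerm x N h (n + 1)

/-- The `n`-th term `n^{N-2h} / (e^{n^N x} - 1)` of the generalized Lambert series, for `n ≥ 1`. -/
def lambertTerm (x : ℝ) (N : ℕ) (h : ℤ) (n : ℕ) : ℝ :=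
  (n : ℝ) ^ ((N : ℤ) - 2 * h) / (Real.exp ((n : ℝ) ^ N * x) - 1)

end KTY

end

namespace KTY

open Complex MeasureTheory Set

/-! The Lambert series is an inverse Mellin transform. Expanding `1 / (e^y - 1)` geometrically and
writing each `e^{-p}` as the integral of `Γ(s) p^{-s}` over a vertical line turns the left side into
`(1 / 2πi) ∫ Γ(s) ζ(s) ζ(Ns - N + 2h) x^{-s} ds` on a line far to the right (`hasSum_lambertTerm`).
Moving this line far to the left (`integral_lambertMellin_shift`) leaves residues and a left
integral.

Residues: `Γ ζ` has simple poles at `1`, `0` and the negative odd integers, and the second zeta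
factor has one at `s₀`. By parity `s₀` is never an odd integer, and `N - 2h ≠ -1` says `s₀ ≠ 0`, so
all poles are simple. At `1 - 2j` the residue contains `ζ(2h - 2jN)`, a trivial zero once `j > h /
N`; this is why the extra sum is finite. The total is `P₁` (`sum_lambertPoles`).

Left integral: put `w = N(1 - s) + 1 - 2h` and `v = π(1 - s) / 2`. The functional equations of both
zeta factors produce `Γ(w) ζ(w) ζ(1 - s) sin(Nv) / sin(v)`, up to elementary factors
(`lambertMellin_eq_of_left`). The quotient of sines is the sum of `e^{ivl}` over `l = N-1, N-3, ...,
1-N`, and each `e^{ivl}` rotates the argument of the exponential obtained on inverting the Mellin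
transform. Since `|l| ≤ N - 1`, the rotation stays below `π / 2` and inversion still applies
(`hasSum_integral_Gamma_mul`). Summing the geometric series and pairing `l` with `-l` gives the
`f_j` (`hasSum_sTerm`).

The shift needs decay inside the strip. It comes from rapid decay on the two edges and
Phragmén–Lindelöf, so only a crude exponential bound on `ζ` is required in between. -/

/-! ### Decay of `Γ` on half-integer lines and Mellin inversion of `e^{-p}` for complex `p`. -/

theorem norm_Gamma_half_add_mul_I_le (t : ℝ) :
    ‖Gamma (1 / 2 + t * I)‖ ≤ √(2 * Real.pi) * Real.exp (-(Real.pi / 2) * |t|) := by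
  have h1 : Gamma (1 / 2 + t * I) * Gamma (1 - (1 / 2 + t * I)) = Real.pi / Real.cosh (Real.pi * t) := by
    rw [Complex.Gamma_mul_Gamma_one_sub]
    have : Complex.sin (Real.pi * (1 / 2 + t * I)) = Real.cosh (Real.pi * t) := by
      rw [show (Real.pi : ℂ) * (1 / 2 + t * I) = Real.pi * t * I + Real.pi / 2 by ring,
        Complex.sin_add_pi_div_two, Complex.cos_mul_I]
      push_cast; rfl
    rw [this]
  -- On this line `1 - s` is the conjugate of `s`, so the reflection formula becomes `|Γ(s)|² = π /
  -- cosh(πt)`.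
  have h2 : (1 : ℂ) - (1 / 2 + t * I) = starRingEnd ℂ (1 / 2 + t * I) := by
    simp only [map_add, map_mul, conj_I, conj_ofReal, map_div₀, map_one, map_ofNat]; ring
  rw [h2, Complex.Gamma_conj, Complex.mul_conj] at h1
  have h3 : normSq (Gamma (1 / 2 + t * I)) = Real.pi / Real.cosh (Real.pi * t) := by
    exact_mod_cast h1
  rw [Complex.normSq_eq_norm_sq] at h3
  have h4 : Real.exp (Real.pi * |t|) / 2 ≤ Real.cosh (Real.pi * t) := by
    rw [← Real.cosh_abs, abs_mul, abs_of_pos Real.pi_pos, Real.cosh_eq]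
    have := Real.exp_pos (-(Real.pi * |t|))
    linarith
  have h5 : ‖Gamma (1 / 2 + t * I)‖ ^ 2 ≤ (√(2 * Real.pi) * Real.exp (-(Real.pi / 2) * |t|)) ^ 2 := by
    rw [h3, mul_pow, Real.sq_sqrt (by positivity), ← Real.exp_nat_mul]
    have : ((2 : ℕ) : ℝ) * (-(Real.pi / 2) * |t|) = -(Real.pi * |t|) := by push_cast; ring
    rw [this, Real.exp_neg, div_le_iff₀ (Real.cosh_pos _)]
    have h6 := Real.exp_pos (Real.pi * |t|)
    have h7 : Real.pi = 2 * Real.pi * (Real.exp (Real.pi * |t|))⁻¹ * (Real.exp (Real.pi * |t|) / 2) := by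
      field_simp
    calc Real.pi = _ := h7
      _ ≤ _ := by gcongr
  exact (pow_le_pow_iff_left₀ (norm_nonneg _) (by positivity) two_ne_zero).1 h5

/-- The recursion `Γ(s + 1) = s Γ(s)` carries the exact decay on `Re s = 1/2` to every half-integer
line at polynomial cost, which replaces Stirling. This is why integration lines are taken at `k +
1/2`. -/
theorem exists_norm_Gamma_half_add_nat_le (k : ℕ) :
    ∃ C : ℝ, 0 < C ∧ ∀ t : ℝ, ‖Gamma (((k + 1 / 2 : ℝ) : ℂ) + t * I)‖ ≤
      C * (1 + |t|) ^ k * Real.exp (-(Real.pi / 2) * |t|) := by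
  induction k with
  | zero =>
    refine ⟨√(2 * Real.pi), by positivity, fun t => ?_⟩
    have := norm_Gamma_half_add_mul_I_le t
    simpa using this
  | succ k ih =>
    obtain ⟨C, hC, h⟩ := ih
    refine ⟨C * (k + 1), by positivity, fun t => ?_⟩
    have h1 : (((k + 1 : ℕ) + 1 / 2 : ℝ) : ℂ) + t * I = ((k + 1 / 2 : ℝ) : ℂ) + t * I + 1 := by
      push_cast; ring
    have h0 : ((k + 1 / 2 : ℝ) : ℂ) + t * I ≠ 0 := by
      intro h0
      have := congrArg Complex.re h0
      simp at this
      have h' : (0 : ℝ) < k + 2⁻¹ := by positivity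
      linarith
    rw [h1, Complex.Gamma_add_one _ h0, norm_mul]
    have h2 : ‖((k + 1 / 2 : ℝ) : ℂ) + t * I‖ ≤ (k + 1) * (1 + |t|) := by
      refine (norm_add_le _ _).trans ?_
      rw [norm_mul, norm_I, mul_one, Complex.norm_real, Complex.norm_real, Real.norm_eq_abs,
        Real.norm_eq_abs, abs_of_pos (by positivity)]
      nlinarith [abs_nonneg t, (Nat.cast_nonneg k : (0 : ℝ) ≤ k)]
    calc _ ≤ ((k + 1) * (1 + |t|)) * (C * (1 + |t|) ^ k * Real.exp (-(Real.pi / 2) * |t|)) :=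
          mul_le_mul h2 (h t) (norm_nonneg _) (by positivity)
      _ = _ := by ring

theorem integrable_one_add_abs_pow_mul_exp (k : ℕ) {a : ℝ} (ha : 0 < a) :
    Integrable fun t : ℝ => (1 + |t|) ^ k * Real.exp (-a * |t|) := by
  have h1 : IntegrableOn (fun t : ℝ => (1 + t) ^ k * Real.exp (-a * t)) (Ioi 0) := by
    refine integrable_of_isBigO_exp_neg (b := a / 2) (by positivity) (by fun_prop) ?_
    have h2 : (fun t : ℝ => (1 + t) ^ k) =O[atTop] fun t => t ^ k := by
      refine Asymptotics.IsBigO.pow ?_ k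
      refine Asymptotics.IsBigO.of_bound 2 ?_
      filter_upwards [eventually_ge_atTop 1] with t ht
      rw [Real.norm_of_nonneg (by linarith), Real.norm_of_nonneg (by linarith)]
      linarith
    have h3 : (fun t : ℝ => t ^ k) =O[atTop] fun t => Real.exp (a / 2 * t) := by
      exact (isLittleO_pow_exp_pos_mul_atTop k (by positivity)).isBigO
    have h4 := (h2.trans h3).mul (Asymptotics.isBigO_refl (fun t => Real.exp (-a * t)) atTop)
    refine h4.congr_right fun t => ?_
    rw [← Real.exp_add]; congr 1; ring
  have h2 : IntegrableOn (fun t : ℝ => (1 + |t|) ^ k * Real.exp (-a * |t|)) (Ioi 0) :=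
    h1.congr_fun (fun t ht => by simp only [abs_of_pos (show 0 < t from ht)]) measurableSet_Ioi
  rw [← integrableOn_univ, ← Iic_union_Ioi (a := (0 : ℝ))]
  refine IntegrableOn.union ?_ h2
  have hn : MeasurableEmbedding (Neg.neg : ℝ → ℝ) := (Homeomorph.neg ℝ).measurableEmbedding
  rw [← Measure.map_neg_eq_self (volume : Measure ℝ), hn.integrableOn_map_iff]
  simp_rw [Function.comp_def, abs_neg, neg_preimage, neg_Iic, neg_zero]
  exact Iff.mpr integrableOn_Ici_iff_integrableOn_Ioi h2

theorem integrableOn_cpow_mul_exp_neg {a p : ℂ} (ha : 0 < a.re) (hp : 0 < p.re) :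
    IntegrableOn (fun t : ℝ => (t : ℂ) ^ (a - 1) * exp (-(p * t))) (Ioi 0) := by
  have hm : AEStronglyMeasurable (fun t : ℝ => (t : ℂ) ^ (a - 1) * exp (-(p * t)))
      (volume.restrict (Ioi 0)) := by
    refine ContinuousOn.aestronglyMeasurable (fun t ht => ?_) measurableSet_Ioi
    refine ContinuousAt.continuousWithinAt (ContinuousAt.mul ?_ (by fun_prop))
    exact continuousAt_ofReal_cpow_const _ _ (Or.inr (ne_of_gt ht))
  refine Integrable.mono' (integrableOn_rpow_mul_exp_neg_mul_rpow (p := 1) (s := a.re - 1) (b := p.re)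
    (by linarith) (by norm_num) hp) hm ?_
  refine (ae_restrict_mem measurableSet_Ioi).mono fun t ht => ?_
  rw [norm_mul, norm_cpow_eq_rpow_re_of_pos ht, Complex.norm_exp]
  simp

/-- For real `p > 0` this is Euler's integral. Both sides are analytic in the half-plane `Re p > 0`,
so the identity theorem at the point `1` extends it. -/
theorem laplace_cpow {a p : ℂ} (ha : 0 < a.re) (hp : 0 < p.re) :
    ∫ t : ℝ in Ioi 0, (t : ℂ) ^ (a - 1) * exp (-(p * t)) = Gamma a * p ^ (-a) := by
  have hU : IsOpen {z : ℂ | 0 < z.re} := isOpen_lt continuous_const continuous_re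
  have hF : AnalyticOnNhd ℂ (fun z : ℂ => ∫ t : ℝ in Ioi 0, (t : ℂ) ^ (a - 1) * exp (-(z * t)))
      {z : ℂ | 0 < z.re} := by
    refine DifferentiableOn.analyticOnNhd (fun z hz => ?_) hU
    have hz' : 0 < z.re := hz
    refine (DifferentiableAt.differentiableWithinAt ?_)
    refine (hasDerivAt_integral_of_dominated_loc_of_deriv_le (μ := volume.restrict (Ioi 0))
      (F := fun z (t : ℝ) => (t : ℂ) ^ (a - 1) * exp (-(z * t)))
      (F' := fun z (t : ℝ) => (t : ℂ) ^ (a - 1) * (exp (-(z * t)) * (-t)))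
      -- On the disc of radius `Re z / 2` about `z` every `w` has `Re w > Re z / 2`; differentiation
      -- costs one power of `t`.
      (bound := fun t : ℝ => t ^ a.re * Real.exp (-(z.re / 2) * t ^ (1 : ℝ)))
      (Metric.ball_mem_nhds z (half_pos hz')) ?_ (integrableOn_cpow_mul_exp_neg ha hz') ?_ ?_
      (integrableOn_rpow_mul_exp_neg_mul_rpow (by linarith) (by norm_num) (half_pos hz')) ?_).2.differentiableAt
    · filter_upwards [hU.mem_nhds hz] with w hw
      exact (integrableOn_cpow_mul_exp_neg ha hw).aestronglyMeasurable
    · have := (integrableOn_cpow_mul_exp_neg ha hz').aestronglyMeasurable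
      have h2 : AEStronglyMeasurable (fun t : ℝ => (-t : ℂ)) (volume.restrict (Ioi 0)) := by
        fun_prop
      exact (this.mul h2).congr (Eventually.of_forall fun t => by simp [mul_assoc])
    · refine (ae_restrict_mem measurableSet_Ioi).mono fun t ht w hw => ?_
      have ht' : 0 < t := ht
      rw [norm_mul, norm_mul, norm_cpow_eq_rpow_re_of_pos ht, Complex.norm_exp, norm_neg, norm_real,
        Real.norm_of_nonneg ht'.le, Real.rpow_one]
      have h1 : z.re / 2 < w.re := by
        have h3 : |(w - z).re| < z.re / 2 := (abs_re_le_norm _).trans_lt (by simpa [dist_eq] using hw)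
        rw [sub_re] at h3
        linarith [(abs_lt.1 h3).1]
      have h2 : t ^ a.re = t ^ (a - 1).re * t := by
        rw [sub_re, one_re, Real.rpow_sub_one ht'.ne']; field_simp
      rw [h2, mul_assoc, mul_comm t]
      gcongr
      simp only [neg_re, mul_re, ofReal_re, ofReal_im, mul_zero, sub_zero]
      nlinarith
    · refine Eventually.of_forall fun t w _ => ?_
      have h1 : HasDerivAt (fun w : ℂ => -(w * t)) (-t) w := by
        simpa using ((hasDerivAt_id w).mul_const (t : ℂ)).fun_neg
      exact (h1.cexp).const_mul _
  have hG : AnalyticOnNhd ℂ (fun z : ℂ => Gamma a * z ^ (-a)) {z : ℂ | 0 < z.re} := by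
    refine DifferentiableOn.analyticOnNhd (fun z hz => ?_) hU
    refine DifferentiableAt.differentiableWithinAt ?_
    exact (differentiableAt_id.cpow_const (Or.inl hz)).const_mul _
  have hpc : IsPreconnected {z : ℂ | 0 < z.re} := (convex_halfSpace_re_gt 0).isPreconnected
  refine hF.eqOn_of_preconnected_of_frequently_eq hG hpc (z₀ := 1) (by simp) ?_ hp
  have ht : Tendsto (fun r : ℝ => (r : ℂ)) (𝓝[≠] 1) (𝓝[≠] 1) := by
    refine tendsto_nhdsWithin_iff.2 ⟨?_, ?_⟩
    · exact (continuous_ofReal.tendsto' 1 1 (by simp)).mono_left nhdsWithin_le_nhds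
    · filter_upwards [self_mem_nhdsWithin] with r hr
      simpa using hr
  refine ht.frequently (Eventually.frequently ?_)
  filter_upwards [nhdsWithin_le_nhds (lt_mem_nhds (zero_lt_one (α := ℝ)))] with r hr
  rw [integral_cpow_mul_exp_neg_mul_Ioi ha hr, mul_comm, one_div, cpow_neg, inv_cpow]
  rw [arg_ofReal_of_nonneg hr.le]; exact Real.pi_pos.ne

/-- The growth `e^{|arg p| |t|}` competes with the decay `e^{-π|t|/2}` of `Γ`; hence the condition
`|arg p| < π / 2` throughout. -/
theorem norm_Gamma_mul_cpow_le (k : ℕ) {p : ℂ} (hp : p ≠ 0) (t : ℝ) :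
    ‖p ^ (-(((k + 1 / 2 : ℝ) : ℂ) + t * I))‖ ≤ ‖p‖ ^ (-(k + 1 / 2 : ℝ)) * Real.exp (|arg p| * |t|) := by
  rw [norm_cpow_of_ne_zero hp]
  simp only [neg_re, add_re, ofReal_re, mul_re, I_re, mul_zero, ofReal_im, I_im, mul_one, sub_self,
    add_zero, neg_im, add_im, mul_im, zero_add]
  rw [div_eq_mul_inv, ← Real.exp_neg]
  gcongr
  rw [← abs_mul]
  calc -(arg p * -t) = arg p * t := by ring
    _ ≤ _ := le_abs_self _

theorem integrable_Gamma_mul_exp (k : ℕ) {b : ℝ} (hb : b < Real.pi / 2) :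
    Integrable fun t : ℝ => ‖Gamma (((k + 1 / 2 : ℝ) : ℂ) + t * I)‖ * Real.exp (b * |t|) := by
  obtain ⟨C, hC, h⟩ := exists_norm_Gamma_half_add_nat_le k
  have h1 := (integrable_one_add_abs_pow_mul_exp k (sub_pos.2 hb)).const_mul C
  refine h1.mono' (Continuous.aestronglyMeasurable ?_) (Eventually.of_forall fun t => ?_)
  · refine Continuous.mul (continuous_norm.comp ?_) (by fun_prop)
    refine continuous_iff_continuousAt.2 fun t => ?_
    refine ContinuousAt.comp (f := fun t : ℝ => ((k + 1 / 2 : ℝ) : ℂ) + t * I)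
      (differentiableAt_Gamma _ fun m hm => ?_).continuousAt (by fun_prop)
    have := congrArg re hm
    simp at this
    have h' : (0 : ℝ) < k + 2⁻¹ := by positivity
    linarith [(Nat.cast_nonneg m : (0 : ℝ) ≤ m)]
  · rw [norm_mul, norm_norm, Real.norm_of_nonneg (Real.exp_pos _).le]
    calc _ ≤ (C * (1 + |t|) ^ k * Real.exp (-(Real.pi / 2) * |t|)) * Real.exp (b * |t|) := by
          gcongr; exact h t
      _ = _ := by
        rw [mul_assoc, ← Real.exp_add, mul_assoc]; congr 3; ring

theorem continuous_Gamma_mul_cpow (k : ℕ) {p : ℂ} (hp : p ≠ 0) :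
    Continuous fun t : ℝ =>
      Gamma (((k + 1 / 2 : ℝ) : ℂ) + t * I) * p ^ (-(((k + 1 / 2 : ℝ) : ℂ) + t * I)) := by
  refine Continuous.mul ?_ ?_
  · refine continuous_iff_continuousAt.2 fun t => ?_
    refine ContinuousAt.comp (f := fun t : ℝ => ((k + 1 / 2 : ℝ) : ℂ) + t * I)
      (differentiableAt_Gamma _ fun m hm => ?_).continuousAt (by fun_prop)
    have := congrArg re hm
    simp at this
    have h' : (0 : ℝ) < k + 2⁻¹ := by positivity
    linarith [(Nat.cast_nonneg m : (0 : ℝ) ≤ m)]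
  · exact Continuous.const_cpow (by fun_prop) (Or.inl hp)

theorem integrable_Gamma_mul_cpow (k : ℕ) {p : ℂ} (hp : 0 < p.re) :
    Integrable fun t : ℝ =>
      Gamma (((k + 1 / 2 : ℝ) : ℂ) + t * I) * p ^ (-(((k + 1 / 2 : ℝ) : ℂ) + t * I)) := by
  have hp0 : p ≠ 0 := by rintro rfl; simp at hp
  refine ((integrable_Gamma_mul_exp k (abs_arg_lt_pi_div_two_iff.2 (Or.inl hp))).const_mul
    (‖p‖ ^ (-(k + 1 / 2 : ℝ)))).mono' (continuous_Gamma_mul_cpow k hp0).aestronglyMeasurable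
    (Eventually.of_forall fun t => ?_)
  rw [norm_mul]
  calc _ ≤ ‖Gamma (((k + 1 / 2 : ℝ) : ℂ) + t * I)‖ *
      (‖p‖ ^ (-(k + 1 / 2 : ℝ)) * Real.exp (|arg p| * |t|)) := by
        gcongr; exact norm_Gamma_mul_cpow_le k hp0 t
    _ = _ := by ring

/-- Mellin inversion of `t ↦ e^{-pt}`, evaluated at `t = 1`. -/
theorem integral_Gamma_mul_cpow (k : ℕ) {p : ℂ} (hp : 0 < p.re) :
    ∫ t : ℝ, Gamma (((k + 1 / 2 : ℝ) : ℂ) + t * I) * p ^ (-(((k + 1 / 2 : ℝ) : ℂ) + t * I)) =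
      2 * Real.pi * exp (-p) := by
  have hk : (0 : ℝ) < k + 1 / 2 := by positivity
  have hm : ∀ t : ℝ, mellin (fun t : ℝ => exp (-(p * t))) (((k + 1 / 2 : ℝ) : ℂ) + t * I) =
      Gamma (((k + 1 / 2 : ℝ) : ℂ) + t * I) * p ^ (-(((k + 1 / 2 : ℝ) : ℂ) + t * I)) := by
    intro t
    have : 0 < (((k + 1 / 2 : ℝ) : ℂ) + t * I).re := by simp; positivity
    rw [← laplace_cpow this hp, mellin]
    rfl
  have h1 := mellinInv_mellin_eq (k + 1 / 2 : ℝ) (fun t : ℝ => exp (-(p * t))) one_pos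
    (integrableOn_cpow_mul_exp_neg (by rwa [ofReal_re]) hp)
    (by simpa only [VerticalIntegrable, hm] using integrable_Gamma_mul_cpow k hp)
    (by fun_prop)
  rw [mellinInv] at h1
  simp only [hm, ofReal_one, one_cpow, one_smul, mul_one] at h1
  rw [← h1, real_smul, ← mul_assoc]
  have : (2 * Real.pi * ((1 / (2 * Real.pi) : ℝ) : ℂ)) = 1 := by
    push_cast; field_simp
  rw [this, one_mul]

/-! ### Removable singularities and shifting a vertical line across simple poles. -/

/-- The product has positive order, so the order of `f` exceeds `-1`; orders are integers or
infinite. -/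
theorem meromorphicOrderAt_nonneg_of_tendsto_mul {f : ℂ → ℂ} {z : ℂ} (hf : MeromorphicAt f z)
    (h : Tendsto (fun w => (w - z) * f w) (𝓝[≠] z) (𝓝 0)) : 0 ≤ meromorphicOrderAt f z := by
  have h1 : MeromorphicAt (fun w : ℂ => w - z) z := by fun_prop
  have h2 := (tendsto_zero_iff_meromorphicOrderAt_pos (h1.mul hf)).1 h
  rw [meromorphicOrderAt_mul h1 hf] at h2
  have h3 : meromorphicOrderAt (fun w : ℂ => w - z) z = 1 := meromorphicOrderAt_id_sub_const
  rw [h3] at h2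
  cases ho : meromorphicOrderAt f z with
  | top => simp
  | coe n =>
    rw [ho] at h2
    norm_cast at h2 ⊢
    omega

theorem analyticAt_toMeromorphicNFOn {f : ℂ → ℂ} (hf : MeromorphicOn f univ) {z : ℂ}
    (h : Tendsto (fun w => (w - z) * f w) (𝓝[≠] z) (𝓝 0)) :
    AnalyticAt ℂ (toMeromorphicNFOn f univ) z := by
  have h1 := meromorphicNFOn_toMeromorphicNFOn f univ (mem_univ z)
  rw [← h1.meromorphicOrderAt_nonneg_iff_analyticAt, meromorphicOrderAt_toMeromorphicNFOn hf (mem_univ z)]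
  exact meromorphicOrderAt_nonneg_of_tendsto_mul (hf z (mem_univ z)) h

theorem toMeromorphicNFOn_eq_of_analyticAt {f : ℂ → ℂ} (hf : MeromorphicOn f univ) {z : ℂ}
    (h : AnalyticAt ℂ f z) : toMeromorphicNFOn f univ z = f z := by
  rw [toMeromorphicNFOn_eq_toMeromorphicNFAt hf (mem_univ z),
    toMeromorphicNFAt_eq_self.2 h.meromorphicNFAt]

/-- A primitive is `arctan(y / c) - (i / 2) log(c² + y²)`. The logarithm is even, so it drops out of
the symmetric integral, whose limit exists although the integrand is not integrable on the whole
line. -/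
theorem integral_inv_add_mul_I {c : ℝ} (hc : c ≠ 0) (T : ℝ) :
    ∫ y in (-T)..T, ((c : ℂ) + y * I)⁻¹ = (2 * Real.arctan (T / c) : ℝ) := by
  have hpos : ∀ y : ℝ, 0 < c ^ 2 + y ^ 2 := fun y => by positivity
  have hne : ∀ y : ℝ, (c : ℂ) + y * I ≠ 0 := fun y h => hc (by simpa using congrArg re h)
  have hd : ∀ y ∈ uIcc (-T) T, HasDerivAt
      (fun y : ℝ => ((Real.arctan (y / c) : ℝ) : ℂ) - I / 2 * (Real.log (c ^ 2 + y ^ 2) : ℝ))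
      ((c : ℂ) + y * I)⁻¹ y := by
    intro y _
    have h1 := (((hasDerivAt_id y).div_const c).arctan).ofReal_comp
    have h2 := ((((hasDerivAt_id y).pow 2).const_add (c ^ 2)).log (hpos y).ne').ofReal_comp
    refine (h1.sub (h2.const_mul (I / 2))).congr_deriv ?_
    have h3 : (c : ℂ) ^ 2 + y ^ 2 ≠ 0 := by exact_mod_cast (hpos y).ne'
    have h4 : ((c : ℂ) + y * I)⁻¹ = (c - y * I) / (c ^ 2 + y ^ 2) := by
      rw [eq_div_iff h3, inv_mul_eq_iff_eq_mul₀ (hne y)]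
      linear_combination ((y : ℂ) ^ 2) * I_sq
    have h5 : (1 : ℝ) / (1 + (id y / c) ^ 2) * (1 / c) = c / (c ^ 2 + y ^ 2) := by
      simp only [id]
      have := (hpos y).ne'
      field_simp
    rw [h4, h5]
    simp only [id, Pi.pow_apply]
    push_cast
    field_simp
  rw [intervalIntegral.integral_eq_sub_of_hasDerivAt hd]
  · simp only [neg_div, Real.arctan_neg, neg_sq]
    push_cast; ring
  · refine Continuous.intervalIntegrable ?_ _ _
    exact Continuous.inv₀ (by fun_prop) hne

theorem tendsto_integral_inv_add_mul_I_of_pos {c : ℝ} (hc : 0 < c) :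
    Tendsto (fun T : ℝ => ∫ y in (-T)..T, ((c : ℂ) + y * I)⁻¹) atTop (𝓝 Real.pi) := by
  simp_rw [integral_inv_add_mul_I hc.ne']
  refine (continuous_ofReal.tendsto _).comp ?_
  have h1 : Tendsto (fun T : ℝ => Real.arctan (T / c)) atTop (𝓝 (Real.pi / 2)) :=
    (Real.tendsto_arctan_atTop.mono_right nhdsWithin_le_nhds).comp (tendsto_id.atTop_div_const hc)
  simpa [mul_div_cancel₀] using h1.const_mul 2

theorem tendsto_integral_inv_add_mul_I_of_neg {c : ℝ} (hc : c < 0) :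
    Tendsto (fun T : ℝ => ∫ y in (-T)..T, ((c : ℂ) + y * I)⁻¹) atTop (𝓝 (-Real.pi)) := by
  have h := (tendsto_integral_inv_add_mul_I_of_pos (neg_pos.2 hc)).neg
  refine h.congr fun T => ?_
  rw [integral_inv_add_mul_I hc.ne, integral_inv_add_mul_I (neg_pos.2 hc).ne', div_neg,
    Real.arctan_neg]
  push_cast; ring

/-- Moving a vertical line of integration across finitely many simple poles on the real axis. -/
theorem integral_vertical_shift {g : ℂ → ℂ} {a b : ℝ} (hab : a < b) (hg : MeromorphicOn g univ)
    (Q : Finset ℝ) (hQ : ∀ p ∈ Q, a < p ∧ p < b) (R : ℂ → ℂ)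
    (hRQ : ∀ s : ℂ, a ≤ s.re → s.re ≤ b → R s ≠ 0 → ∃ p ∈ Q, (p : ℂ) = s)
    (hlim : ∀ s : ℂ, a ≤ s.re → s.re ≤ b →
      Tendsto (fun z => (z - s) * g z) (𝓝[≠] s) (𝓝 (R s)))
    (hana : ∀ s : ℂ, a ≤ s.re → s.re ≤ b → (s.re = a ∨ s.re = b ∨ 1 ≤ |s.im|) → AnalyticAt ℂ g s)
    {C : ℝ} (hbound : ∀ s : ℂ, a ≤ s.re → s.re ≤ b → 1 ≤ |s.im| → ‖g s‖ ≤ C / s.im ^ 2)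
    (hia : Integrable fun t : ℝ => g (a + t * I)) (hib : Integrable fun t : ℝ => g (b + t * I)) :
    (∫ t : ℝ, g (b + t * I)) - ∫ t : ℝ, g (a + t * I) = 2 * Real.pi * ∑ p ∈ Q, R p := by
  -- With the principal parts subtracted only removable singularities remain in the strip. The
  -- normal form `E` fills them in, so Cauchy's theorem applies to `E` on rectangles, on whose
  -- boundary it agrees with `g₀`.
  set g₀ : ℂ → ℂ := fun z => g z - ∑ p ∈ Q, R p * (z - p)⁻¹ with hg₀
  have hmero : MeromorphicOn g₀ univ := by
    intro z _
    have h1 := hg z (mem_univ z)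
    refine h1.sub ?_
    refine MeromorphicAt.fun_sum fun p _ => ?_
    fun_prop
  set E := toMeromorphicNFOn g₀ univ with hE
  have hEana : ∀ s : ℂ, a ≤ s.re → s.re ≤ b → AnalyticAt ℂ E s := by
    intro s h1 h2
    refine analyticAt_toMeromorphicNFOn hmero ?_
    have h3 : Tendsto (fun z : ℂ => ∑ p ∈ Q, (z - s) * (R p * (z - p)⁻¹)) (𝓝[≠] s)
        (𝓝 (∑ p ∈ Q, if (p : ℂ) = s then R p else 0)) := by
      refine tendsto_finsetSum _ fun p _ => ?_
      split_ifs with hps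
      · refine tendsto_const_nhds.congr' ?_
        filter_upwards [self_mem_nhdsWithin] with z hz
        have : z - s ≠ 0 := sub_ne_zero.2 hz
        rw [hps]; field_simp
      · have h4 : ContinuousAt (fun z : ℂ => (z - s) * (R p * (z - p)⁻¹)) s := by
          refine ContinuousAt.mul (by fun_prop) (ContinuousAt.mul continuousAt_const ?_)
          exact ContinuousAt.inv₀ (by fun_prop) (sub_ne_zero.2 (Ne.symm hps))
        have h5 := h4.tendsto.mono_left (nhdsWithin_le_nhds (s := {s}ᶜ))
        simpa using h5
    have h4 : (∑ p ∈ Q, if (p : ℂ) = s then R p else 0) = R s := by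
      by_cases hR : R s = 0
      · rw [hR]
        refine Finset.sum_eq_zero fun p _ => ?_
        split_ifs with hps
        · rw [hps, hR]
        · rfl
      · obtain ⟨q, hq, rfl⟩ := hRQ s h1 h2 hR
        rw [Finset.sum_eq_single_of_mem q hq]
        · simp
        · intro p _ hp
          rw [if_neg]
          exact_mod_cast hp
    rw [h4] at h3
    have h5 := (hlim s h1 h2).sub h3
    rw [sub_self] at h5
    refine h5.congr fun z => ?_
    rw [hg₀]
    simp only [mul_sub, Finset.mul_sum]
  have hEeq : ∀ s : ℂ, a ≤ s.re → s.re ≤ b → (s.re = a ∨ s.re = b ∨ 1 ≤ |s.im|) → E s = g₀ s := by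
    intro s h1 h2 h3
    refine toMeromorphicNFOn_eq_of_analyticAt hmero ?_
    refine (hana s h1 h2 h3).sub ?_
    refine Finset.analyticAt_fun_sum _ fun p hp => ?_
    refine analyticAt_const.mul (AnalyticAt.inv (by fun_prop) (sub_ne_zero.2 ?_))
    rintro rfl
    simp only [ofReal_re, ofReal_im, abs_zero] at h3
    have := hQ p hp
    rcases h3 with h3 | h3 | h3 <;> linarith
  have hrect : ∀ T : ℝ, 1 ≤ T →
      I * ((∫ y in (-T)..T, g₀ (b + y * I)) - ∫ y in (-T)..T, g₀ (a + y * I)) =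
      (∫ x in a..b, g₀ (x + T * I)) - ∫ x in a..b, g₀ (x + (-T : ℝ) * I) := by
    intro T hT
    have h1 := Complex.integral_boundary_rect_eq_zero_of_differentiableOn E (a + (-T : ℝ) * I)
      (b + T * I) ?_
    · simp only [add_re, ofReal_re, mul_re, I_re, mul_zero, ofReal_im, I_im, mul_one, sub_self,
        add_zero, add_im, mul_im, zero_add, smul_eq_mul] at h1
      have e1 : ∫ x in a..b, E (x + (-T : ℝ) * I) = ∫ x in a..b, g₀ (x + (-T : ℝ) * I) := by
        refine intervalIntegral.integral_congr fun x hx => ?_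
        rw [uIcc_of_le hab.le] at hx
        refine hEeq _ (by simpa using hx.1) (by simpa using hx.2) (Or.inr (Or.inr ?_))
        simpa [abs_of_nonneg (zero_le_one.trans hT)] using hT
      have e2 : ∫ x in a..b, E (x + T * I) = ∫ x in a..b, g₀ (x + T * I) := by
        refine intervalIntegral.integral_congr fun x hx => ?_
        rw [uIcc_of_le hab.le] at hx
        refine hEeq _ (by simpa using hx.1) (by simpa using hx.2) (Or.inr (Or.inr ?_))
        simpa [abs_of_nonneg (zero_le_one.trans hT)] using hT
      have e3 : ∫ y in (-T)..T, E (b + y * I) = ∫ y in (-T)..T, g₀ (b + y * I) := by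
        refine intervalIntegral.integral_congr fun y _ => ?_
        exact hEeq _ (by simpa using hab.le) (by simp) (by simp)
      have e4 : ∫ y in (-T)..T, E (a + y * I) = ∫ y in (-T)..T, g₀ (a + y * I) := by
        refine intervalIntegral.integral_congr fun y _ => ?_
        exact hEeq _ (by simp) (by simpa using hab.le) (by simp)
      rw [e1, e2, e3, e4] at h1
      linear_combination h1
    · intro z hz
      rw [mem_reProdIm] at hz
      simp only [add_re, ofReal_re, mul_re, I_re, mul_zero, ofReal_im, I_im, mul_one, sub_self,
        add_zero] at hz
      rw [uIcc_of_le hab.le] at hz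
      exact (hEana z hz.1.1 hz.1.2).differentiableAt.differentiableWithinAt
  -- The subtracted terms weaken the decay to `1 / |Im s|`, which still kills the horizontal sides
  -- since their length is fixed.
  set D : ℝ := |C| + ∑ p ∈ Q, ‖R p‖ with hD
  have hD0 : 0 ≤ D := by positivity
  have hg₀b : ∀ s : ℂ, a ≤ s.re → s.re ≤ b → 1 ≤ |s.im| → ‖g₀ s‖ ≤ D / |s.im| := by
    intro s h1 h2 h3
    have h4 : 0 < |s.im| := by linarith
    refine (norm_sub_le _ _).trans ?_
    rw [hD, add_div, Finset.sum_div]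
    refine add_le_add ?_ ((norm_sum_le _ _).trans (Finset.sum_le_sum fun p _ => ?_))
    · refine (hbound s h1 h2 h3).trans ?_
      rw [← sq_abs]
      calc C / |s.im| ^ 2 ≤ |C| / |s.im| ^ 2 := by gcongr; exact le_abs_self C
        _ ≤ |C| / |s.im| := by gcongr; nlinarith
    · rw [norm_mul, norm_inv, ← div_eq_mul_inv]
      gcongr
      calc |s.im| = |(s - p).im| := by simp
        _ ≤ _ := abs_im_le_norm _
  have hhor : ∀ ε : ℝ, ε = 1 ∨ ε = -1 →
      Tendsto (fun T : ℝ => ∫ x in a..b, g₀ (x + (ε * T : ℝ) * I)) atTop (𝓝 0) := by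
    intro ε hε
    have h1 : Tendsto (fun T : ℝ => D / T * |b - a|) atTop (𝓝 0) := by
      simpa using (tendsto_const_nhds.div_atTop tendsto_id).mul_const |b - a|
    refine squeeze_zero_norm' ?_ h1
    filter_upwards [eventually_ge_atTop 1] with T hT
    have h2 : |ε * T| = T := by
      rcases hε with rfl | rfl <;> simp [abs_of_nonneg (zero_le_one.trans hT)]
    refine intervalIntegral.norm_integral_le_of_norm_le_const fun x hx => ?_
    rw [uIoc_of_le hab.le] at hx
    have := hg₀b (x + (ε * T : ℝ) * I) (by simpa using hx.1.le) (by simpa using hx.2)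
      (by simpa [-abs_mul, h2] using hT)
    simpa [-abs_mul, h2] using this
  have hvert : ∀ c : ℝ, (∀ p ∈ Q, c ≠ p) → (Integrable fun t : ℝ => g (c + t * I)) → ∀ T : ℝ,
      ∫ y in (-T)..T, g₀ (c + y * I) = (∫ y in (-T)..T, g (c + y * I)) -
        ∑ p ∈ Q, R p * ∫ y in (-T)..T, (((c - p : ℝ) : ℂ) + y * I)⁻¹ := by
    intro c hc hi T
    have hci : ∀ p ∈ Q, IntervalIntegrable (fun y : ℝ => R p * (((c - p : ℝ) : ℂ) + y * I)⁻¹)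
        volume (-T) T := by
      intro p hp
      refine Continuous.intervalIntegrable (continuous_const.mul (Continuous.inv₀ (by fun_prop) ?_)) _ _
      intro y h
      exact sub_ne_zero.2 (hc p hp) (by simpa using congrArg re h)
    have e : ∀ y : ℝ, g₀ (c + y * I) = g (c + y * I) -
        ∑ p ∈ Q, R p * (((c - p : ℝ) : ℂ) + y * I)⁻¹ := by
      intro y
      simp only [hg₀]
      congr 1
      refine Finset.sum_congr rfl fun p _ => ?_
      congr 2
      push_cast; ring
    simp_rw [e]
    rw [intervalIntegral.integral_sub hi.intervalIntegrable, intervalIntegral.integral_finsetSum hci]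
    · simp_rw [intervalIntegral.integral_const_mul]
    · simpa only [Finset.sum_fn] using IntervalIntegrable.sum Q hci
  have hL := (hhor 1 (Or.inl rfl)).sub (hhor (-1) (Or.inr rfl))
  -- Each pole lies left of the line `b` and right of the line `a`, so its principal part
  -- contributes `π` and `-π` times the residue; the difference is the factor `2π`.
  have hlimb := (intervalIntegral_tendsto_integral hib tendsto_neg_atTop_atBot tendsto_id).sub
    (tendsto_finsetSum Q fun p hp => (tendsto_integral_inv_add_mul_I_of_pos
      (sub_pos.2 (hQ p hp).2)).const_mul (R p))
  have hlima := (intervalIntegral_tendsto_integral hia tendsto_neg_atTop_atBot tendsto_id).sub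
    (tendsto_finsetSum Q fun p hp => (tendsto_integral_inv_add_mul_I_of_neg
      (sub_neg.2 (hQ p hp).1)).const_mul (R p))
  have hLHS := (hlimb.sub hlima).const_mul I
  have huniq := tendsto_nhds_unique (hLHS.congr' ?_) hL
  · rw [sub_self, mul_eq_zero, or_iff_right I_ne_zero] at huniq
    rw [← Finset.sum_mul, ← Finset.sum_mul] at huniq
    linear_combination huniq
  · filter_upwards [eventually_ge_atTop 1] with T hT
    have h1 := hrect T hT
    rw [hvert b (fun p hp => (hQ p hp).2.ne') hib, hvert a (fun p hp => (hQ p hp).1.ne) hia] at h1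
    simpa using h1

/-! ### Crude growth of `Γ`, `1/Γ` and `ζ` in vertical strips. -/

theorem norm_Gamma_le_Gamma_re {s : ℂ} (hs : 0 < s.re) : ‖Gamma s‖ ≤ Real.Gamma s.re := by
  rw [Complex.Gamma_eq_integral hs, Real.Gamma_eq_integral hs, GammaIntegral]
  refine (norm_integral_le_integral_norm _).trans_eq ?_
  refine setIntegral_congr_fun measurableSet_Ioi fun t ht => ?_
  simp only [norm_mul, norm_real, Real.norm_of_nonneg (Real.exp_pos _).le]
  rw [norm_cpow_eq_rpow_re_of_pos ht]
  simp

theorem exists_norm_Gamma_le_of_one_le_abs_im (a b : ℝ) :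
    ∃ C : ℝ, ∀ s : ℂ, a ≤ s.re → s.re ≤ b → 1 ≤ |s.im| → ‖Gamma s‖ ≤ C := by
  obtain ⟨n, hn⟩ := exists_nat_ge (1 - a)
  obtain ⟨C, hC⟩ := (isCompact_Icc (a := a + n) (b := b + n)).exists_bound_of_continuousOn
    (f := Real.Gamma) fun x hx => by
      refine (Real.differentiableAt_Gamma fun m hm => ?_).continuousAt.continuousWithinAt
      have := hx.1
      have h0 : (0 : ℝ) ≤ m := Nat.cast_nonneg m
      linarith
  -- Moving one unit to the right multiplies `Γ` by a factor of modulus at least `|Im s| ≥ 1`, and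
  -- after `n` steps the real part is at least `1`.
  have hstep : ∀ (m : ℕ) (s : ℂ), 1 ≤ |s.im| → ‖Gamma s‖ ≤ ‖Gamma (s + m)‖ := by
    intro m
    induction m with
    | zero => simp
    | succ m ih =>
      intro s hs
      refine (ih s hs).trans ?_
      have h1 : 1 ≤ ‖s + m‖ := by
        refine le_trans ?_ (abs_im_le_norm _)
        simpa using hs
      have h2 : s + m ≠ 0 := norm_pos_iff.1 (by linarith)
      rw [Nat.cast_succ, ← add_assoc, Complex.Gamma_add_one _ h2, norm_mul]
      exact le_mul_of_one_le_left (norm_nonneg _) h1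
  refine ⟨C, fun s h1 h2 h3 => (hstep n s h3).trans ?_⟩
  have h4 : (s + n).re = s.re + n := by simp
  refine (norm_Gamma_le_Gamma_re (by rw [h4]; linarith)).trans ?_
  rw [h4]
  exact (le_abs_self _).trans (hC _ ⟨by linarith, by linarith⟩)

theorem norm_sin_le_exp_abs_im (z : ℂ) : ‖sin z‖ ≤ Real.exp |z.im| := by
  rw [Complex.sin, norm_div, norm_mul, norm_I, mul_one, Complex.norm_ofNat, div_le_iff₀ two_pos]
  refine (norm_sub_le _ _).trans ?_
  rw [Complex.norm_exp, Complex.norm_exp]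
  have h1 : Real.exp (-z * I).re ≤ Real.exp |z.im| := by
    gcongr; simpa using le_abs_self z.im
  have h2 : Real.exp (z * I).re ≤ Real.exp |z.im| := by
    gcongr; simpa using neg_le_abs z.im
  linarith

/-- By reflection `1 / Γ(s) = Γ(1 - s) sin(πs) / π`; the exponential is that of the sine. -/
theorem exists_norm_inv_Gamma_le (a b : ℝ) :
    ∃ C : ℝ, ∀ s : ℂ, a ≤ s.re → s.re ≤ b → 1 ≤ |s.im| →
      ‖(Gamma s)⁻¹‖ ≤ C * Real.exp (Real.pi * |s.im|) := by
  obtain ⟨C, hC⟩ := exists_norm_Gamma_le_of_one_le_abs_im (1 - b) (1 - a)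
  refine ⟨C / Real.pi, fun s h1 h2 h3 => ?_⟩
  have him : s.im ≠ 0 := by rintro h; rw [h] at h3; norm_num at h3
  have hsin : sin (Real.pi * s) ≠ 0 := by
    rw [Complex.sin_ne_zero_iff]
    intro k hk
    have h4 : (Real.pi : ℂ) ≠ 0 := by exact_mod_cast Real.pi_pos.ne'
    have h5 : s = k := by
      apply mul_left_cancel₀ h4; rw [hk]; ring
    exact him (by rw [h5]; simp)
  have hpi : (Real.pi : ℂ) ≠ 0 := by exact_mod_cast Real.pi_pos.ne'
  have h4 := Complex.Gamma_mul_Gamma_one_sub s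
  have h5 : Gamma s ≠ 0 := by
    intro h0
    rw [h0, zero_mul] at h4
    exact div_ne_zero hpi hsin h4.symm
  have h6 : (Gamma s)⁻¹ = Gamma (1 - s) * sin (Real.pi * s) / Real.pi := by
    rw [inv_eq_iff_eq_inv, inv_div, eq_div_iff, ← mul_assoc, h4]
    · field_simp
    · refine mul_ne_zero (fun h0 => ?_) hsin
      rw [h0, mul_zero] at h4
      exact div_ne_zero hpi hsin h4.symm
  have h7 : (Real.pi * s).im = Real.pi * s.im := by simp
  have hC1 := hC (1 - s) (by simp; linarith) (by simp; linarith) (by simpa using h3)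
  rw [h6, norm_div, norm_mul, norm_real, Real.norm_of_nonneg Real.pi_pos.le, div_mul_eq_mul_div]
  gcongr
  · exact (norm_nonneg _).trans hC1
  · refine (norm_sin_le_exp_abs_im _).trans_eq ?_
    rw [h7, abs_mul, abs_of_pos Real.pi_pos]

theorem exists_norm_mellin_le {f : ℝ → ℂ} {a b : ℝ} (ha : MellinConvergent f a)
    (hb : MellinConvergent f b) :
    ∃ C : ℝ, ∀ s : ℂ, a ≤ s.re → s.re ≤ b → ‖mellin f s‖ ≤ C := by
  have hint : Integrable (fun t : ℝ => ‖(t : ℂ) ^ ((a : ℂ) - 1) • f t‖ + ‖(t : ℂ) ^ ((b : ℂ) - 1) • f t‖)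
      (volume.restrict (Ioi 0)) := ha.norm.add hb.norm
  refine ⟨_, fun s h1 h2 => norm_integral_le_of_norm_le hint ?_⟩
  refine (ae_restrict_mem measurableSet_Ioi).mono fun t ht => ?_
  have ht' : 0 < t := ht
  simp only [norm_smul]
  rw [norm_cpow_eq_rpow_re_of_pos ht, norm_cpow_eq_rpow_re_of_pos ht,
    norm_cpow_eq_rpow_re_of_pos ht, ← add_mul]
  gcongr
  simp only [sub_re, ofReal_re, one_re]
  rcases le_total 1 t with h | h
  · refine (Real.rpow_le_rpow_of_exponent_le h (by linarith : s.re - 1 ≤ b - 1)).trans ?_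
    linarith [Real.rpow_pos_of_pos ht' (a - 1)]
  · refine (Real.rpow_le_rpow_of_exponent_ge ht' h (by linarith : a - 1 ≤ s.re - 1)).trans ?_
    linarith [Real.rpow_pos_of_pos ht' (b - 1)]

/-- The entire part of the completed zeta function is a Mellin transform that converges absolutely
at every point, hence it is bounded on each strip by its values at the two edges. -/
theorem exists_norm_completedRiemannZeta₀_le (a b : ℝ) :
    ∃ C : ℝ, ∀ s : ℂ, a ≤ s.re → s.re ≤ b → ‖completedRiemannZeta₀ s‖ ≤ C := by
  let P := HurwitzZeta.hurwitzEvenFEPair 0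
  obtain ⟨C, hC⟩ := exists_norm_mellin_le (f := P.f_modif) (a := a / 2) (b := b / 2)
    (P.isStrongFEPair_toStrongFEPair.hasMellin _).1 (P.isStrongFEPair_toStrongFEPair.hasMellin _).1
  refine ⟨C / 2, fun s h1 h2 => ?_⟩
  have : completedRiemannZeta₀ s = mellin P.f_modif (s / 2) / 2 := rfl
  rw [this, norm_div, Complex.norm_ofNat]
  gcongr
  refine hC _ ?_ ?_ <;> rw [Complex.div_ofNat_re] <;> linarith

/-- Exponential growth is far from sharp but is all that Phragmén–Lindelöf needs. The threshold `2`
makes `|Im(s / 2)| ≥ 1`, as required for the bound on `1 / Γ(s / 2)`. -/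
theorem exists_norm_riemannZeta_le (a b : ℝ) :
    ∃ C : ℝ, ∀ s : ℂ, a ≤ s.re → s.re ≤ b → 2 ≤ |s.im| →
      ‖riemannZeta s‖ ≤ C * Real.exp (Real.pi * |s.im|) := by
  obtain ⟨C, hC⟩ := exists_norm_completedRiemannZeta₀_le a b
  obtain ⟨D, hD⟩ := exists_norm_inv_Gamma_le (a / 2) (b / 2)
  refine ⟨(C + 1 + 1) * (Real.pi ^ (b / 2) * D), fun s h1 h2 h3 => ?_⟩
  have hs0 : s ≠ 0 := by rintro rfl; norm_num at h3
  have hn : 1 ≤ ‖s‖ := by linarith [abs_im_le_norm s]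
  have hn' : 1 ≤ ‖1 - s‖ := by
    have := abs_im_le_norm (1 - s)
    simp at this; linarith
  have e1 : ‖completedRiemannZeta s‖ ≤ C + 1 + 1 := by
    rw [completedRiemannZeta_eq]
    refine (norm_sub_le _ _).trans (add_le_add ((norm_sub_le _ _).trans (add_le_add (hC s h1 h2) ?_)) ?_)
    · rw [norm_div, norm_one]; exact div_le_one_of_le₀ hn (norm_nonneg _)
    · rw [norm_div, norm_one]; exact div_le_one_of_le₀ hn' (norm_nonneg _)
  have e2 : ‖(Gammaℝ s)⁻¹‖ ≤ Real.pi ^ (b / 2) * D * Real.exp (Real.pi * |s.im|) := by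
    have h4 := hD (s / 2) (by rw [Complex.div_ofNat_re]; linarith)
      (by rw [Complex.div_ofNat_re]; linarith)
      (by rw [Complex.div_ofNat_im, abs_div, abs_two]; linarith)
    have hD0 : 0 ≤ D := by
      have := (norm_nonneg _).trans h4
      exact nonneg_of_mul_nonneg_left this (Real.exp_pos _)
    rw [Gammaℝ_def, mul_inv, norm_mul, ← cpow_neg, norm_cpow_eq_rpow_re_of_pos Real.pi_pos, mul_assoc]
    have h5 : (-(-s / 2)).re = s.re / 2 := by
      rw [neg_div, neg_neg, Complex.div_ofNat_re]
    rw [h5]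
    refine mul_le_mul ?_ (h4.trans ?_) (norm_nonneg _) (by positivity)
    · exact Real.rpow_le_rpow_of_exponent_le (by linarith [Real.pi_gt_three]) (by linarith)
    · have h6 : |(s / 2).im| ≤ |s.im| := by
        rw [Complex.div_ofNat_im, abs_div, abs_two]
        linarith [abs_nonneg s.im]
      gcongr
  rw [riemannZeta_def_of_ne_zero hs0, div_eq_mul_inv, norm_mul, mul_assoc]
  exact mul_le_mul e1 e2 (norm_nonneg _) ((norm_nonneg _).trans e1)

/-! ### Quadratic decay inside a strip from decay on its edges. -/

/-- Phragmén–Lindelöf on a vertical strip, for a function with finitely many simple real poles. -/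
theorem exists_norm_le_div_sq_of_edges {g : ℂ → ℂ} {a b : ℝ} (hab : a < b)
    (hg : MeromorphicOn g univ) (Q : Finset ℝ) (R : ℂ → ℂ)
    (hRQ : ∀ s : ℂ, a ≤ s.re → s.re ≤ b → R s ≠ 0 → ∃ p ∈ Q, (p : ℂ) = s)
    (hlim : ∀ s : ℂ, a ≤ s.re → s.re ≤ b →
      Tendsto (fun z => (z - s) * g z) (𝓝[≠] s) (𝓝 (R s)))
    (hana : ∀ s : ℂ, a ≤ s.re → s.re ≤ b → (s.re = a ∨ s.re = b ∨ 1 ≤ |s.im|) → AnalyticAt ℂ g s)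
    (hedge : ∃ C : ℝ, ∀ s : ℂ, s.re = a ∨ s.re = b → ‖g s‖ * (1 + |s.im|) ^ (Q.card + 2) ≤ C)
    (hgrowth : ∃ A B : ℝ, ∀ s : ℂ, a ≤ s.re → s.re ≤ b → 2 ≤ |s.im| →
      ‖g s‖ ≤ A * Real.exp (B * |s.im|)) :
    ∃ C : ℝ, ∀ s : ℂ, a ≤ s.re → s.re ≤ b → 1 ≤ |s.im| → ‖g s‖ ≤ C / s.im ^ 2 := by
  -- The product cancels the poles and `z ^ 2` supplies the decay claimed. The degree of `q` is the
  -- exponent `Q.card + 2` in `hedge`.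
  set q : ℂ → ℂ := fun z => (∏ p ∈ Q, (z - p)) * z ^ 2 with hq
  have hqa : ∀ z, AnalyticAt ℂ q z := by
    intro z
    refine AnalyticAt.mul (Finset.analyticAt_fun_prod _ fun p _ => by fun_prop) (by fun_prop)
  have hm : MeromorphicOn (fun z => g z * q z) univ :=
    fun z hz => (hg z hz).mul (hqa z).meromorphicAt
  set f := toMeromorphicNFOn (fun z => g z * q z) univ with hf
  have hfana : ∀ s : ℂ, a ≤ s.re → s.re ≤ b → AnalyticAt ℂ f s := by
    intro s h1 h2
    refine analyticAt_toMeromorphicNFOn hm ?_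
    have h3 := (hlim s h1 h2).mul ((hqa s).continuousAt.tendsto.mono_left nhdsWithin_le_nhds)
    have h4 : R s * q s = 0 := by
      by_cases hR : R s = 0
      · rw [hR, zero_mul]
      · obtain ⟨p, hp, rfl⟩ := hRQ s h1 h2 hR
        have : q p = 0 := by
          simp only [hq]
          rw [Finset.prod_eq_zero (f := fun r : ℝ => (p : ℂ) - r) hp (sub_self _), zero_mul]
        rw [this, mul_zero]
    rw [h4] at h3
    exact h3.congr fun z => by ring
  have hfeq : ∀ s : ℂ, a ≤ s.re → s.re ≤ b → (s.re = a ∨ s.re = b ∨ 1 ≤ |s.im|) →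
      f s = g s * q s := fun s h1 h2 h3 =>
    toMeromorphicNFOn_eq_of_analyticAt hm ((hana s h1 h2 h3).mul (hqa s))
  obtain ⟨M, hM0, hM⟩ : ∃ M : ℝ, 1 ≤ M ∧ ∀ s : ℂ, a ≤ s.re → s.re ≤ b →
      ‖s‖ ≤ M * (1 + |s.im|) ∧ ∀ p ∈ Q, ‖s - p‖ ≤ M * (1 + |s.im|) := by
    refine ⟨1 + |a| + |b| + ∑ p ∈ Q, |p|, ?_, fun s h1 h2 => ?_⟩
    · have : 0 ≤ ∑ p ∈ Q, |p| := by positivity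
      linarith [abs_nonneg a, abs_nonneg b]
    have h0 : 0 ≤ ∑ p ∈ Q, |p| := by positivity
    have h3 : ‖s‖ ≤ |a| + |b| + |s.im| := by
      refine (norm_le_abs_re_add_abs_im s).trans ?_
      gcongr
      exact abs_le.2 ⟨by linarith [neg_abs_le a, abs_nonneg b],
        by linarith [le_abs_self b, abs_nonneg a]⟩
    have h4 : ∀ y : ℝ, |a| + |b| + |s.im| + y ≤ (1 + |a| + |b| + y) * (1 + |s.im|) - 1 -
        |s.im| * (|a| + |b| + y) := fun y => by ring_nf; rfl
    constructor
    · nlinarith [abs_nonneg a, abs_nonneg b, abs_nonneg s.im]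
    · intro p hp
      have h5 : |p| ≤ ∑ p ∈ Q, |p| := Finset.single_le_sum (fun i _ => abs_nonneg i) hp
      have h6 : ‖s - p‖ ≤ ‖s‖ + |p| := by
        simpa using norm_sub_le s (p : ℂ)
      nlinarith [abs_nonneg a, abs_nonneg b, abs_nonneg s.im]
  have hqn : ∀ s : ℂ, a ≤ s.re → s.re ≤ b →
      ‖q s‖ ≤ M ^ (Q.card + 2) * (1 + |s.im|) ^ (Q.card + 2) := by
    intro s h1 h2
    obtain ⟨h3, h4⟩ := hM s h1 h2
    rw [← mul_pow, pow_add]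
    simp only [hq, norm_mul, norm_prod, norm_pow]
    gcongr
    refine (Finset.prod_le_prod (fun _ _ => norm_nonneg _) h4).trans_eq ?_
    rw [Finset.prod_const]
  obtain ⟨C, hC⟩ := hedge
  have hedge' : ∀ s : ℂ, s.re = a ∨ s.re = b → ‖f s‖ ≤ M ^ (Q.card + 2) * C := by
    intro s hs
    have h1 : a ≤ s.re := by rcases hs with h | h <;> rw [h]; exact hab.le
    have h2 : s.re ≤ b := by rcases hs with h | h <;> rw [h]; exact hab.le
    rw [hfeq s h1 h2 (by tauto), norm_mul]
    calc ‖g s‖ * ‖q s‖ ≤ ‖g s‖ * (M ^ (Q.card + 2) * (1 + |s.im|) ^ (Q.card + 2)) := by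
          gcongr; exact hqn s h1 h2
      _ = M ^ (Q.card + 2) * (‖g s‖ * (1 + |s.im|) ^ (Q.card + 2)) := by ring
      _ ≤ _ := by gcongr; exact hC s hs
  have hdiff : DiffContOnCl ℂ f (re ⁻¹' Ioo a b) := by
    refine DifferentiableOn.diffContOnCl fun z hz => ?_
    have h1 : z ∈ re ⁻¹' Icc a b := by
      refine closure_minimal (preimage_mono Ioo_subset_Icc_self) (isClosed_Icc.preimage continuous_re) hz
    exact (hfana z h1.1 h1.2).differentiableAt.differentiableWithinAt
  have hB : ∃ c < Real.pi / (b - a), ∃ B,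
      f =O[comap (_root_.abs ∘ im) atTop ⊓ 𝓟 (re ⁻¹' Ioo a b)]
        fun z ↦ Real.exp (B * Real.exp (c * |z.im|)) := by
    obtain ⟨A, B, hAB⟩ := hgrowth
    have hba : 0 < b - a := sub_pos.2 hab
    set c := Real.pi / (2 * (b - a)) with hc
    have hc0 : 0 < c := by positivity
    -- Here `c` is half the critical rate `π / (b - a)`. The coefficient collects `A ≤ e^{|A|}`, `M
    -- ≤ e^M`, `1 + t ≤ e^t` and `t ≤ e^{ct} / c`.
    refine ⟨c, ?_, |A| + ((Q.card + 2) * M + |B| / c + (Q.card + 2) / c), ?_⟩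
    · rw [hc]
      exact div_lt_div_of_pos_left Real.pi_pos hba (by linarith)
    refine Asymptotics.IsBigO.of_bound 1 ?_
    filter_upwards [mem_inf_of_left (preimage_mem_comap (eventually_ge_atTop (2 : ℝ))),
      mem_inf_of_right (mem_principal_self _)] with s hs1 hs2
    have hs1 : 2 ≤ |s.im| := hs1
    have h1 : a ≤ s.re := hs2.1.le
    have h2 : s.re ≤ b := hs2.2.le
    rw [one_mul, Real.norm_of_nonneg (Real.exp_pos _).le,
      hfeq s h1 h2 (Or.inr (Or.inr (by linarith))), norm_mul]
    set t := |s.im|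
    have e1 : 1 ≤ Real.exp (c * t) := Real.one_le_exp (by positivity)
    have e2 : t ≤ Real.exp (c * t) / c := by
      rw [le_div_iff₀ hc0]
      linarith [Real.add_one_le_exp (c * t)]
    have e3 : A ≤ Real.exp |A| := by
      linarith [Real.add_one_le_exp |A|, le_abs_self A]
    have e4 : M ≤ Real.exp M := by linarith [Real.add_one_le_exp M]
    have e5 : 1 + t ≤ Real.exp t := by linarith [Real.add_one_le_exp t]
    calc ‖g s‖ * ‖q s‖ ≤ (A * Real.exp (B * t)) * (M ^ (Q.card + 2) * (1 + t) ^ (Q.card + 2)) :=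
          mul_le_mul (hAB s h1 h2 hs1) (hqn s h1 h2) (norm_nonneg _)
            ((norm_nonneg _).trans (hAB s h1 h2 hs1))
      _ ≤ (Real.exp |A| * Real.exp (|B| * t)) *
          (Real.exp M ^ (Q.card + 2) * Real.exp t ^ (Q.card + 2)) := by
          gcongr
          exact le_abs_self B
      _ = Real.exp (|A| + ((Q.card + 2) * M + |B| * t + (Q.card + 2) * t)) := by
          rw [← Real.exp_nat_mul, ← Real.exp_nat_mul, ← Real.exp_add, ← Real.exp_add, ← Real.exp_add]
          congr 1; push_cast; ring
      _ ≤ _ := by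
          gcongr
          set e := Real.exp (c * t)
          have f1 : |A| ≤ |A| * e := le_mul_of_one_le_right (abs_nonneg _) e1
          have f2 : (Q.card + 2) * M ≤ (Q.card + 2) * M * e :=
            le_mul_of_one_le_right (by positivity) e1
          have f3 : |B| * t ≤ |B| / c * e := by
            calc |B| * t ≤ |B| * (e / c) := by gcongr
              _ = _ := by ring
          have f4 : (Q.card + 2) * t ≤ (Q.card + 2) / c * e := by
            calc (Q.card + 2) * t ≤ (Q.card + 2) * (e / c) := by gcongr
              _ = _ := by ring
          linarith
  refine ⟨M ^ (Q.card + 2) * C, fun s h1 h2 h3 => ?_⟩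
  have h4 := PhragmenLindelof.vertical_strip hdiff hB (fun z hz => hedge' z (Or.inl hz))
    (fun z hz => hedge' z (Or.inr hz)) h1 h2
  rw [hfeq s h1 h2 (Or.inr (Or.inr h3)), norm_mul] at h4
  -- The poles are real, so each factor `s - p` has modulus at least `|Im s| ≥ 1`.
  have h5 : s.im ^ 2 ≤ ‖q s‖ := by
    simp only [hq, norm_mul, norm_prod, norm_pow]
    have h6 : 1 ≤ ∏ p ∈ Q, ‖s - p‖ := by
      calc (1 : ℝ) = ∏ p ∈ Q, 1 := by simp
        _ ≤ _ := Finset.prod_le_prod (fun _ _ => zero_le_one) fun p _ => h3.trans (by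
          simpa using abs_im_le_norm (s - p))
    have h7 : s.im ^ 2 ≤ ‖s‖ ^ 2 := by
      rw [← sq_abs]; gcongr; exact abs_im_le_norm s
    calc s.im ^ 2 ≤ 1 * ‖s‖ ^ 2 := by rwa [one_mul]
      _ ≤ _ := by gcongr
  have h8 : 0 < s.im ^ 2 := by rw [← sq_abs]; positivity
  rw [le_div_iff₀ h8]
  exact (mul_le_mul_of_nonneg_left h5 (norm_nonneg _)).trans h4

/-! ### Singularities of `Γ ζ`. -/

theorem analyticAt_Gamma {s : ℂ} (hs : ∀ m : ℕ, s ≠ -m) : AnalyticAt ℂ Gamma s := by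
  have h1 : AnalyticAt ℂ (fun s : ℂ => (Gamma s)⁻¹) s :=
    (differentiable_one_div_Gamma).analyticAt s
  refine (h1.inv (inv_ne_zero (Gamma_ne_zero hs))).congr (Eventually.of_forall fun z => ?_)
  simp

theorem analyticAt_riemannZeta {s : ℂ} (hs : s ≠ 1) : AnalyticAt ℂ riemannZeta s :=
  differentiableOn_riemannZeta.analyticAt (isOpen_compl_singleton.mem_nhds hs)

/-- The right side no longer contains `Γ`, so at the negative integers the behaviour of `Γ ζ` can be
read off from the zeros of the cosine. -/
theorem Gamma_mul_riemannZeta_eq {s : ℂ} (hs : ∀ m : ℕ, s ≠ -m) (hs1 : s ≠ 1)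
    (hc : cos (Real.pi * s / 2) ≠ 0) :
    Gamma s * riemannZeta s =
      (2 * Real.pi : ℂ) ^ s * riemannZeta (1 - s) / (2 * cos (Real.pi * s / 2)) := by
  have hpi : (2 * Real.pi : ℂ) ≠ 0 := by
    exact_mod_cast (by positivity : (2 * Real.pi : ℝ) ≠ 0)
  rw [riemannZeta_one_sub hs hs1, cpow_neg]
  have := cpow_ne_zero_iff_of_exponent_ne_zero (x := (2 * Real.pi : ℂ)) (y := s)
    (fun h => hs 0 (by simpa using h))
  have := this.2 hpi
  field_simp

theorem eventually_ne_neg_nat_of_eq_neg_nat (m : ℕ) :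
    ∀ᶠ z : ℂ in 𝓝[≠] (-m : ℂ), ∀ n : ℕ, z ≠ -n := by
  filter_upwards [self_mem_nhdsWithin, nhdsWithin_le_nhds (Metric.ball_mem_nhds _ one_pos)]
    with z hz hb n hn
  have hz' : z ≠ -m := hz
  rw [hn, Metric.mem_ball, dist_eq] at hb
  have h1 : (-(n : ℂ) - -m) = ((-(n : ℤ) + m : ℤ) : ℂ) := by push_cast; ring
  rw [h1, norm_intCast] at hb
  have h2 : (-(n : ℤ) + m) = 0 := by
    rw [← Int.abs_lt_one_iff]; exact_mod_cast hb
  apply hz'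
  rw [hn, show n = m by omega]

theorem eventually_Gamma_mul_riemannZeta_eq {m : ℕ} :
    ∀ᶠ z : ℂ in 𝓝[≠] (-m : ℂ), cos (Real.pi * z / 2) ≠ 0 → Gamma z * riemannZeta z =
      (2 * Real.pi : ℂ) ^ z * riemannZeta (1 - z) / (2 * cos (Real.pi * z / 2)) := by
  have h1 : (-m : ℂ) ≠ 1 := by
    intro h
    have := congrArg re h
    simp at this
    linarith [(Nat.cast_nonneg m : (0 : ℝ) ≤ m)]
  filter_upwards [eventually_ne_neg_nat_of_eq_neg_nat m,
    nhdsWithin_le_nhds (isOpen_ne.mem_nhds h1)] with z hz hz1 hc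
  exact Gamma_mul_riemannZeta_eq hz hz1 hc

theorem analyticAt_two_pi_cpow_mul_riemannZeta {s : ℂ} (hs : s ≠ 0) :
    AnalyticAt ℂ (fun z : ℂ => (2 * Real.pi : ℂ) ^ z * riemannZeta (1 - z)) s := by
  have hpi : (2 * Real.pi : ℂ) ∈ slitPlane := by
    refine Or.inl ?_
    have : (2 * Real.pi : ℂ) = ((2 * Real.pi : ℝ) : ℂ) := by push_cast; rfl
    rw [this, ofReal_re]; positivity
  refine (AnalyticAt.cpow analyticAt_const analyticAt_id hpi).mul ?_
  refine AnalyticAt.fun_comp (g := riemannZeta) (f := fun z => 1 - z) (analyticAt_riemannZeta ?_) (by fun_prop)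
  intro h
  exact hs (by linear_combination -h)

/-- `Γ ζ` has a finite limit away from `1`, `0` and the negative odd integers. -/
theorem exists_tendsto_Gamma_mul_riemannZeta {s : ℂ} (h1 : s ≠ 1) (h0 : s ≠ 0)
    (hodd : ∀ j : ℕ, 1 ≤ j → s ≠ 1 - 2 * j) :
    ∃ r, Tendsto (fun z => Gamma z * riemannZeta z) (𝓝[≠] s) (𝓝 r) := by
  by_cases hs : ∀ m : ℕ, s ≠ -m
  · exact ⟨_, ((analyticAt_Gamma hs).mul (analyticAt_riemannZeta h1)).continuousAt.tendsto.mono_left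
      nhdsWithin_le_nhds⟩
  push Not at hs
  obtain ⟨m, rfl⟩ := hs
  obtain ⟨k, rfl | rfl⟩ := m.even_or_odd'
  -- At `-2k` the cosine is `±1`, so the pole of `Γ` is cancelled by the trivial zero of `ζ`; `h0`
  -- rules out `k = 0`.
  · have hc : cos (Real.pi * (-(2 * k : ℕ) : ℂ) / 2) ≠ 0 := by
      have : (Real.pi * (-(2 * k : ℕ) : ℂ) / 2) = ((-(k * Real.pi) : ℝ) : ℂ) := by push_cast; ring
      rw [this, ← ofReal_cos, Real.cos_neg, Real.cos_nat_mul_pi]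
      simp
    have hcont : ContinuousAt (fun z : ℂ => (2 * Real.pi : ℂ) ^ z * riemannZeta (1 - z) /
        (2 * cos (Real.pi * z / 2))) (-(2 * k : ℕ) : ℂ) :=
      (analyticAt_two_pi_cpow_mul_riemannZeta h0).continuousAt.div (by fun_prop)
        (mul_ne_zero two_ne_zero hc)
    have hc2 : ContinuousAt (fun z : ℂ => cos (Real.pi * z / 2)) (-(2 * k : ℕ) : ℂ) := by fun_prop
    refine ⟨_, (hcont.tendsto.mono_left nhdsWithin_le_nhds).congr' ?_⟩
    filter_upwards [eventually_Gamma_mul_riemannZeta_eq, nhdsWithin_le_nhds (hc2.eventually_ne hc)]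
      with z hz hz2
    exact (hz hz2).symm
  · exact absurd (by push_cast; ring) (hodd (k + 1) (by omega))

/-- The cosine has a simple zero at `1 - 2j`, and the numerator contains `ζ(2j)`, whose Euler
evaluation cancels the powers of `2π`. -/
theorem tendsto_sub_mul_Gamma_mul_riemannZeta_odd {j : ℕ} (hj : 1 ≤ j) :
    Tendsto (fun z => (z - (1 - 2 * j)) * (Gamma z * riemannZeta z)) (𝓝[≠] (1 - 2 * j : ℂ))
      (𝓝 (bernoulli (2 * j) / (2 * j).factorial)) := by
  have hs : (1 - 2 * j : ℂ) = -((2 * j - 1 : ℕ) : ℂ) := by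
    rw [Nat.cast_sub (by omega)]; push_cast; ring
  have h0 : (1 - 2 * j : ℂ) ≠ 0 := by
    rw [hs, neg_ne_zero, Nat.cast_ne_zero]; omega
  have hpi : (Real.pi : ℂ) ≠ 0 := by exact_mod_cast Real.pi_pos.ne'
  have harg : (Real.pi * (1 - 2 * j : ℂ) / 2) = ((Real.pi / 2 - j * Real.pi : ℝ) : ℂ) := by
    push_cast; ring
  have hcos : cos (Real.pi * (1 - 2 * j : ℂ) / 2) = 0 := by
    rw [harg, ← ofReal_cos, Real.cos_pi_div_two_sub, Real.sin_nat_mul_pi, ofReal_zero]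
  have hsin : sin (Real.pi * (1 - 2 * j : ℂ) / 2) = (-1) ^ j := by
    rw [harg, ← ofReal_sin, Real.sin_pi_div_two_sub, Real.cos_nat_mul_pi]; push_cast; rfl
  have hd : HasDerivAt (fun z : ℂ => cos (Real.pi * z / 2)) (-(-1) ^ j * (Real.pi / 2))
      (1 - 2 * j : ℂ) := by
    have h1 : HasDerivAt (fun z : ℂ => Real.pi * z / 2) (Real.pi / 2) (1 - 2 * j : ℂ) := by
      simpa using ((hasDerivAt_id (1 - 2 * j : ℂ)).const_mul (Real.pi : ℂ)).div_const 2
    have := h1.ccos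
    rwa [hsin] at this
  have hne : -(-1) ^ j * (Real.pi / 2 : ℂ) ≠ 0 := by
    refine mul_ne_zero (neg_ne_zero.2 (pow_ne_zero _ (by norm_num))) (div_ne_zero hpi two_ne_zero)
  have hslope := (hasDerivAt_iff_tendsto_slope.1 hd).inv₀ hne
  have hA := ((analyticAt_two_pi_cpow_mul_riemannZeta h0).continuousAt.tendsto.mono_left
    nhdsWithin_le_nhds).mul hslope |>.div_const 2
  have hval : (2 * Real.pi : ℂ) ^ (1 - 2 * j : ℂ) * riemannZeta (1 - (1 - 2 * j)) *
      (-(-1) ^ j * (Real.pi / 2 : ℂ))⁻¹ / 2 = bernoulli (2 * j) / (2 * j).factorial := by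
    have h2 : (2 * Real.pi : ℂ) ≠ 0 := mul_ne_zero two_ne_zero hpi
    rw [sub_sub_cancel, riemannZeta_two_mul_nat (by omega), cpow_sub _ _ h2, cpow_one]
    have h3 : (2 * Real.pi : ℂ) ^ (2 * j : ℂ) = 2 * 2 ^ (2 * j - 1) * Real.pi ^ (2 * j) := by
      have : (2 * j : ℂ) = ((2 * j : ℕ) : ℂ) := by push_cast; rfl
      rw [this, cpow_natCast, mul_pow, ← pow_succ', show 2 * j - 1 + 1 = 2 * j by omega]
    rw [h3, pow_succ]
    have h4 : ((-1 : ℂ) ^ j) ≠ 0 := pow_ne_zero _ (by norm_num)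
    field_simp
  rw [hval] at hA
  refine hA.congr' ?_
  have hev := eventually_Gamma_mul_riemannZeta_eq (m := 2 * j - 1)
  rw [← hs] at hev
  have hcne : ∀ᶠ z in 𝓝[≠] (1 - 2 * j : ℂ), cos (Real.pi * z / 2) ≠ 0 := hd.eventually_ne hne
  filter_upwards [hev, hcne, self_mem_nhdsWithin] with z hz hc hz1
  rw [hz hc, slope_def_field, hcos, sub_zero, inv_div]
  field_simp

theorem tendsto_mul_Gamma_mul_riemannZeta_zero :
    Tendsto (fun z => (z - 0) * (Gamma z * riemannZeta z)) (𝓝[≠] 0) (𝓝 (-(1 / 2))) := by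
  have h1 := tendsto_self_mul_Gamma_nhds_zero.mul
    ((analyticAt_riemannZeta zero_ne_one).continuousAt.tendsto.mono_left nhdsWithin_le_nhds)
  rw [riemannZeta_zero, one_mul, neg_div] at h1
  exact h1.congr fun z => by ring

theorem tendsto_sub_mul_Gamma_mul_riemannZeta_one :
    Tendsto (fun z => (z - 1) * (Gamma z * riemannZeta z)) (𝓝[≠] 1) (𝓝 1) := by
  have hG : ∀ m : ℕ, (1 : ℂ) ≠ -m := by
    intro m h
    have := congrArg re h
    simp at this
    linarith [(Nat.cast_nonneg m : (0 : ℝ) ≤ m)]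
  have h1 := riemannZeta_residue_one.mul
    ((analyticAt_Gamma hG).continuousAt.tendsto.mono_left nhdsWithin_le_nhds)
  rw [Gamma_one, one_mul] at h1
  exact h1.congr fun z => by ring

/-! ### Poles and residues of `lambertMellin`, and their sum `P₁`. -/

/-- The Mellin transform of `x ↦ ∑ n ^ (N - 2h) / (exp (n ^ N x) - 1)`. -/
noncomputable def lambertMellin (N : ℕ) (h : ℤ) (s : ℂ) : ℂ :=
  Gamma s * riemannZeta s * riemannZeta (N * s - N + 2 * h)

variable {N : ℕ} {h : ℤ}

theorem s₀_mul (hN : 0 < N) : s₀ N h * N = N - 2 * h + 1 := by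
  have : (N : ℝ) ≠ 0 := by positivity
  rw [s₀]; field_simp

theorem eq_s₀_of_eq_one (hN : 0 < N) {s : ℂ} (hs : N * s - N + 2 * h = 1) : s = (s₀ N h : ℂ) := by
  have h0 : (N : ℂ) ≠ 0 := by exact_mod_cast hN.ne'
  have h1 : ((s₀ N h * N : ℝ) : ℂ) = ((N - 2 * h + 1 : ℝ) : ℂ) := by rw [s₀_mul hN]
  push_cast at h1
  apply mul_right_cancel₀ h0
  linear_combination hs - h1

/-- Parity: equality would force `2(h - jN) = 1`. Thus the pole of the second zeta factor never
meets a pole of `Γ ζ` at an odd integer. -/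
theorem ne_s₀_of_odd (hN : 0 < N) (j : ℤ) : s₀ N h ≠ 1 - 2 * j := by
  intro h1
  have h2 := s₀_mul (h := h) hN
  rw [h1] at h2
  have h3 : (1 - 2 * j) * N = (N : ℤ) - 2 * h + 1 := by exact_mod_cast h2
  have h4 : 2 * (h - j * N) = 1 := by linear_combination h3
  omega

theorem s₀_ne_one (hN : 0 < N) : s₀ N h ≠ 1 := by
  simpa using ne_s₀_of_odd (h := h) hN 0

/-- This is where `N - 2h ≠ -1` enters: otherwise the pole of the second zeta factor would fall on
the pole of `Γ` at `0`. -/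
theorem s₀_ne_zero (hN : 0 < N) (hNh : (N : ℤ) - 2 * h ≠ -1) : s₀ N h ≠ 0 := by
  intro h1
  have h2 := s₀_mul (h := h) hN
  rw [h1, zero_mul] at h2
  have h3 : (0 : ℤ) = (N : ℤ) - 2 * h + 1 := by exact_mod_cast h2
  omega

theorem exists_tendsto_Gamma_mul_riemannZeta_s₀ (hN : 0 < N) (hNh : (N : ℤ) - 2 * h ≠ -1) :
    ∃ r, Tendsto (fun z => Gamma z * riemannZeta z) (𝓝[≠] (s₀ N h : ℂ)) (𝓝 r) := by
  refine exists_tendsto_Gamma_mul_riemannZeta ?_ ?_ ?_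
  · exact_mod_cast s₀_ne_one hN
  · exact_mod_cast s₀_ne_zero hN hNh
  · intro j _
    exact_mod_cast ne_s₀_of_odd hN j

theorem tendsto_gammaZeta_s₀ (hN : 0 < N) (hNh : (N : ℤ) - 2 * h ≠ -1) :
    Tendsto (fun z => Gamma z * riemannZeta z) (𝓝[≠] (s₀ N h : ℂ))
      (𝓝 (gammaZeta (s₀ N h : ℂ))) :=
  tendsto_nhds_limUnder (exists_tendsto_Gamma_mul_riemannZeta_s₀ hN hNh)

theorem analyticAt_riemannZeta_comp (hN : 0 < N) {s : ℂ} (hs : s ≠ (s₀ N h : ℂ)) :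
    AnalyticAt ℂ (fun s : ℂ => riemannZeta (N * s - N + 2 * h)) s :=
  AnalyticAt.fun_comp (g := riemannZeta) (f := fun s : ℂ => N * s - N + 2 * h)
    (analyticAt_riemannZeta fun h1 => hs (eq_s₀_of_eq_one hN h1)) (by fun_prop)

theorem tendsto_sub_mul_riemannZeta_comp (hN : 0 < N) :
    Tendsto (fun z : ℂ => (z - s₀ N h) * riemannZeta (N * z - N + 2 * h)) (𝓝[≠] (s₀ N h : ℂ))
      (𝓝 (1 / N)) := by
  have h0 : (N : ℂ) ≠ 0 := by exact_mod_cast hN.ne'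
  have h1 : ((s₀ N h * N : ℝ) : ℂ) = ((N - 2 * h + 1 : ℝ) : ℂ) := by rw [s₀_mul hN]
  push_cast at h1
  have h2 : Tendsto (fun z : ℂ => N * z - N + 2 * h) (𝓝[≠] (s₀ N h : ℂ)) (𝓝[≠] 1) := by
    refine tendsto_nhdsWithin_iff.2 ⟨?_, ?_⟩
    · refine (Continuous.tendsto' (by fun_prop) _ _ ?_).mono_left nhdsWithin_le_nhds
      linear_combination h1
    · filter_upwards [self_mem_nhdsWithin] with z hz hz1
      exact hz (eq_s₀_of_eq_one hN hz1)
  have h3 := (riemannZeta_residue_one.comp h2).div_const (N : ℂ)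
  refine h3.congr fun z => ?_
  simp only [Function.comp]
  rw [div_eq_iff h0]
  linear_combination riemannZeta (N * z - N + 2 * h) * h1

theorem meromorphicAt_riemannZeta (s : ℂ) : MeromorphicAt riemannZeta s := by
  by_cases h1 : s = 1
  · have h2 : MeromorphicAt (fun z => (completedRiemannZeta₀ z - 1 / z - 1 / (1 - z)) * (Gammaℝ z)⁻¹) s := by
      have h3 := (differentiable_completedZeta₀.analyticAt s).meromorphicAt
      have h4 := (differentiable_Gammaℝ_inv.analyticAt s).meromorphicAt
      fun_prop
    refine h2.congr (nhdsWithin_le_nhds ?_)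
    filter_upwards [isOpen_ne.mem_nhds (show s ≠ 0 by rw [h1]; exact one_ne_zero)] with z hz
    rw [riemannZeta_def_of_ne_zero hz, completedRiemannZeta_eq]
    exact (div_eq_mul_inv _ _).symm
  · exact (analyticAt_riemannZeta h1).meromorphicAt

theorem meromorphicOn_lambertMellin : MeromorphicOn (lambertMellin N h) univ := by
  refine fun s _ => (Meromorphic.Gamma s |>.mul (meromorphicAt_riemannZeta s)).mul ?_
  exact (meromorphicAt_riemannZeta _).comp_analyticAt (g := fun s : ℂ => N * s - N + 2 * h) (by fun_prop)

/-- The residue of `lambertMellin N h`. -/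
noncomputable def lambertResidue (N : ℕ) (h : ℤ) (s : ℂ) : ℂ :=
  limUnder (𝓝[≠] s) fun z => (z - s) * lambertMellin N h z

theorem tendsto_lambertMellin_one (hN : 0 < N) :
    Tendsto (fun z => (z - 1) * lambertMellin N h z) (𝓝[≠] 1) (𝓝 (riemannZeta (2 * h))) := by
  have h1 : (1 : ℂ) ≠ (s₀ N h : ℂ) := by exact_mod_cast (s₀_ne_one hN).symm
  have h2 := tendsto_sub_mul_Gamma_mul_riemannZeta_one.mul
    ((analyticAt_riemannZeta_comp hN h1).continuousAt.tendsto.mono_left nhdsWithin_le_nhds)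
  rw [one_mul, mul_one, sub_self, zero_add] at h2
  exact h2.congr fun z => by rw [lambertMellin]; ring

theorem tendsto_lambertMellin_zero (hN : 0 < N) (hNh : (N : ℤ) - 2 * h ≠ -1) :
    Tendsto (fun z => (z - 0) * lambertMellin N h z) (𝓝[≠] 0)
      (𝓝 (-(1 / 2) * riemannZeta (-N + 2 * h))) := by
  have h1 : (0 : ℂ) ≠ (s₀ N h : ℂ) := by exact_mod_cast (s₀_ne_zero hN hNh).symm
  have h2 := tendsto_mul_Gamma_mul_riemannZeta_zero.mul
    ((analyticAt_riemannZeta_comp hN h1).continuousAt.tendsto.mono_left nhdsWithin_le_nhds)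
  rw [mul_zero, zero_sub] at h2
  exact h2.congr fun z => by rw [lambertMellin]; ring

theorem tendsto_lambertMellin_odd (hN : 0 < N) {j : ℕ} (hj : 1 ≤ j) :
    Tendsto (fun z => (z - (1 - 2 * j)) * lambertMellin N h z) (𝓝[≠] (1 - 2 * j : ℂ))
      (𝓝 (bernoulli (2 * j) / (2 * j).factorial * riemannZeta (2 * h - 2 * j * N))) := by
  have h1 : (1 - 2 * j : ℂ) ≠ (s₀ N h : ℂ) := by exact_mod_cast (ne_s₀_of_odd hN j).symm
  have h2 := (tendsto_sub_mul_Gamma_mul_riemannZeta_odd hj).mul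
    ((analyticAt_riemannZeta_comp hN h1).continuousAt.tendsto.mono_left nhdsWithin_le_nhds)
  have h3 : (N * (1 - 2 * j) - N + 2 * h : ℂ) = 2 * h - 2 * j * N := by ring
  rw [h3] at h2
  exact h2.congr fun z => by rw [lambertMellin]; ring

theorem tendsto_lambertMellin_s₀ (hN : 0 < N) (hNh : (N : ℤ) - 2 * h ≠ -1) :
    Tendsto (fun z => (z - s₀ N h) * lambertMellin N h z) (𝓝[≠] (s₀ N h : ℂ))
      (𝓝 (1 / N * gammaZeta (s₀ N h))) := by
  refine ((tendsto_sub_mul_riemannZeta_comp hN).mul (tendsto_gammaZeta_s₀ hN hNh)).congr fun z => ?_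
  rw [lambertMellin]; ring

theorem tendsto_lambertMellin_of_regular (hN : 0 < N) {s : ℂ} (h1 : s ≠ 1) (h0 : s ≠ 0)
    (hodd : ∀ j : ℕ, 1 ≤ j → s ≠ 1 - 2 * j) (hs : s ≠ (s₀ N h : ℂ)) :
    Tendsto (fun z => (z - s) * lambertMellin N h z) (𝓝[≠] s) (𝓝 0) := by
  obtain ⟨r, hr⟩ := exists_tendsto_Gamma_mul_riemannZeta h1 h0 hodd
  have h2 : Tendsto (fun z : ℂ => z - s) (𝓝[≠] s) (𝓝 0) :=
    (Continuous.tendsto' (f := fun z : ℂ => z - s) (by fun_prop) _ _ (sub_self s)).mono_left nhdsWithin_le_nhds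
  have h3 := h2.mul (hr.mul
    ((analyticAt_riemannZeta_comp hN hs).continuousAt.tendsto.mono_left nhdsWithin_le_nhds))
  rw [zero_mul] at h3
  exact h3

/-- These trivial zeros remove the poles at `1 - 2j` with `j > h / N`. -/
theorem riemannZeta_two_mul_of_neg {m : ℤ} (hm : m < 0) : riemannZeta (2 * m) = 0 := by
  obtain ⟨n, rfl⟩ : ∃ n : ℕ, m = -((n : ℤ) + 1) := ⟨(-m - 1).toNat, by omega⟩
  rw [← riemannZeta_neg_two_mul_nat_add_one n]
  congr 1; push_cast; ring

theorem tendsto_lambertResidue (hN : 0 < N) (hNh : (N : ℤ) - 2 * h ≠ -1) (s : ℂ) :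
    Tendsto (fun z => (z - s) * lambertMellin N h z) (𝓝[≠] s) (𝓝 (lambertResidue N h s)) := by
  refine tendsto_nhds_limUnder ?_
  by_cases h1 : s = 1
  · subst h1; exact ⟨_, tendsto_lambertMellin_one hN⟩
  by_cases h0 : s = 0
  · subst h0; exact ⟨_, tendsto_lambertMellin_zero hN hNh⟩
  by_cases hs : s = (s₀ N h : ℂ)
  · subst hs; exact ⟨_, tendsto_lambertMellin_s₀ hN hNh⟩
  by_cases hodd : ∀ j : ℕ, 1 ≤ j → s ≠ 1 - 2 * j
  · exact ⟨_, tendsto_lambertMellin_of_regular hN h1 h0 hodd hs⟩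
  push Not at hodd
  obtain ⟨j, hj, rfl⟩ := hodd
  exact ⟨_, tendsto_lambertMellin_odd hN hj⟩

/-- The poles of `lambertMellin N h`. -/
noncomputable def lambertPoles (N : ℕ) (h : ℤ) : Finset ℝ :=
  {1, 0, s₀ N h} ∪ (Finset.Icc 1 ⌊(h : ℝ) / N⌋₊).image fun j : ℕ => (1 - 2 * j : ℝ)

theorem exists_mem_lambertPoles (hN : 0 < N) (hNh : (N : ℤ) - 2 * h ≠ -1) {s : ℂ}
    (hs : lambertResidue N h s ≠ 0) : ∃ p ∈ lambertPoles N h, (p : ℂ) = s := by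
  by_contra hcon
  push Not at hcon
  have h1 : s ≠ 1 := fun h => hcon 1 (by simp [lambertPoles]) (by simp [h])
  have h0 : s ≠ 0 := fun h => hcon 0 (by simp [lambertPoles]) (by simp [h])
  have h2 : s ≠ (s₀ N h : ℂ) := fun h' => hcon (s₀ N h) (by simp [lambertPoles]) h'.symm
  have hT := tendsto_lambertResidue hN hNh s
  by_cases hodd : ∀ j : ℕ, 1 ≤ j → s ≠ 1 - 2 * j
  · exact hs (tendsto_nhds_unique hT (tendsto_lambertMellin_of_regular hN h1 h0 hodd h2))
  push Not at hodd
  obtain ⟨j, hj, rfl⟩ := hodd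
  by_cases hjh : j ≤ ⌊(h : ℝ) / N⌋₊
  · refine hcon (1 - 2 * j : ℝ) ?_ (by push_cast; rfl)
    exact Finset.mem_union_right _ (Finset.mem_image_of_mem _ (Finset.mem_Icc.2 ⟨hj, hjh⟩))
  · have hN' : (0 : ℝ) < N := by exact_mod_cast hN
    have h3 : (h : ℝ) / N < j := (Nat.floor_lt' (by omega)).1 (not_le.1 hjh)
    rw [div_lt_iff₀ hN'] at h3
    have h4 : h - j * N < 0 := by
      have : h < j * N := by exact_mod_cast h3
      omega
    refine hs (tendsto_nhds_unique hT ?_)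
    have h5 := tendsto_lambertMellin_odd (h := h) hN hj
    have h6 := riemannZeta_two_mul_of_neg h4
    have h7 : (2 * ((h - j * N : ℤ) : ℂ)) = 2 * h - 2 * j * N := by push_cast; ring
    rwa [h7.symm, h6, mul_zero] at h5

theorem sum_lambertPoles (hN : 0 < N) (hNh : (N : ℤ) - 2 * h ≠ -1) (x : ℝ) (hx : 0 < x) :
    ∑ p ∈ lambertPoles N h, lambertResidue N h p * (x : ℂ) ^ (-(p : ℂ)) = P₁ x N h := by
  have hR1 : lambertResidue N h 1 = riemannZeta (2 * h) := (tendsto_lambertMellin_one hN).limUnder_eq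
  have hR0 : lambertResidue N h 0 = -(1 / 2) * riemannZeta (-N + 2 * h) :=
    (tendsto_lambertMellin_zero hN hNh).limUnder_eq
  have hRs : lambertResidue N h (s₀ N h) = 1 / N * gammaZeta (s₀ N h) :=
    (tendsto_lambertMellin_s₀ hN hNh).limUnder_eq
  have hRj : ∀ j : ℕ, 1 ≤ j → lambertResidue N h (1 - 2 * j) =
      bernoulli (2 * j) / (2 * j).factorial * riemannZeta (2 * h - 2 * j * N) := fun j hj =>
    (tendsto_lambertMellin_odd hN hj).limUnder_eq
  have hdisj : Disjoint ({1, 0, s₀ N h} : Finset ℝ)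
      ((Finset.Icc 1 ⌊(h : ℝ) / N⌋₊).image fun j : ℕ => (1 - 2 * j : ℝ)) := by
    rw [Finset.disjoint_right]
    intro p hp
    obtain ⟨j, hj, rfl⟩ := Finset.mem_image.1 hp
    have hj1 := (Finset.mem_Icc.1 hj).1
    have hj2 : (1 : ℝ) ≤ j := by exact_mod_cast hj1
    have h3 := ne_s₀_of_odd (h := h) hN j
    simp only [Finset.mem_insert, Finset.mem_singleton, not_or]
    exact ⟨by linarith, by linarith, by exact_mod_cast h3.symm⟩
  have hx0 : (x : ℂ) ≠ 0 := by exact_mod_cast hx.ne'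
  rw [lambertPoles, Finset.sum_union hdisj, Finset.sum_insert, Finset.sum_insert,
    Finset.sum_singleton, Finset.sum_image, P₁, P]
  · have e1 : (x : ℂ) ^ (-(s₀ N h : ℂ)) = ((x ^ (-s₀ N h) : ℝ) : ℂ) := by
      rw [ofReal_cpow hx.le]; push_cast; rfl
    rw [ofReal_one, ofReal_zero, hR1, hR0, hRs, e1, neg_zero, cpow_zero, cpow_neg_one]
    have e2 : ∑ j ∈ Finset.Icc 1 ⌊(h : ℝ) / N⌋₊,
        lambertResidue N h ((1 - 2 * j : ℝ) : ℂ) * (x : ℂ) ^ (-((1 - 2 * j : ℝ) : ℂ)) =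
        (((-1) ^ (h + 1) * 2 ^ (2 * h - 1) * Real.pi ^ (2 * h)
      * ∑ j ∈ Finset.Icc 1 ⌊(h : ℝ) / N⌋₊, bernoulliTerm x N h j : ℝ) : ℂ) := by
      rw [Finset.mul_sum, ofReal_sum]
      refine Finset.sum_congr rfl fun j hj => ?_
      obtain ⟨hj1, hj2⟩ := Finset.mem_Icc.1 hj
      have hN' : (0 : ℝ) < N := by exact_mod_cast hN
      have h3 : (j : ℝ) ≤ (h : ℝ) / N := (Nat.le_floor_iff' (by omega)).1 hj2
      rw [le_div_iff₀ hN'] at h3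
      have h4 : (j : ℤ) * N ≤ h := by exact_mod_cast h3
      obtain ⟨m, hm⟩ := Int.eq_ofNat_of_zero_le (sub_nonneg.2 h4)
      have h5 : (((1 - 2 * j : ℝ) : ℂ)) = 1 - 2 * j := by push_cast; rfl
      have h6 : (2 * h - 2 * j * N : ℂ) = 2 * (m : ℂ) := by
        have : ((h - j * N : ℤ) : ℂ) = ((m : ℤ) : ℂ) := by rw [hm]
        push_cast at this
        linear_combination 2 * this
      have h7 : (2 * h - 2 * j * N).toNat = 2 * m := by
        have : 2 * h - 2 * j * N = ((2 * m : ℕ) : ℤ) := by push_cast; linear_combination 2 * hm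
        rw [this, Int.toNat_natCast]
      -- The integer exponent lets Euler's formula include `m = 0`, where it reads `ζ(0) = -1/2`.
      have h8 : riemannZeta (2 * (m : ℂ)) = (-1) ^ (m + 1) * 2 ^ (2 * (m : ℤ) - 1) * Real.pi ^ (2 * m) *
          bernoulli (2 * m) / (2 * m).factorial := by
        rcases Nat.eq_zero_or_pos m with rfl | hm0
        · simp [riemannZeta_zero]; norm_num
        · rw [riemannZeta_two_mul_nat hm0.ne']
          congr 4
          rw [← zpow_natCast]; congr 1; omega
      have h9 : (x : ℂ) ^ (-(1 - 2 * j : ℂ)) = (x : ℂ) ^ (2 * j - 1) := by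
        rw [← cpow_natCast]; congr 1
        rw [Nat.cast_sub (by omega)]; push_cast; ring
      have h10 : h = m + ((j * N : ℕ) : ℤ) := by push_cast; linear_combination hm
      rw [h5, hRj j hj1, h6, h8, h9, bernoulliTerm, h7]
      have hpi : (Real.pi : ℂ) ≠ 0 := by exact_mod_cast Real.pi_pos.ne'
      push_cast
      -- Since `h = m + jN`, the factor `(-1 / 4π²)^{jN}` turns the prefactor in `h` into Euler's
      -- prefactor in `m`.
      have f1 : ((-1 : ℂ)) ^ (h + 1) = (-1) ^ (m + 1) * (-1) ^ (j * N) := by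
        rw [h10, show ((m : ℤ) + ((j * N : ℕ) : ℤ) + 1) = ((m + 1 + j * N : ℕ) : ℤ) by push_cast; ring,
          zpow_natCast, pow_add]
      have f2 : (2 : ℂ) ^ (2 * h - 1) = 2 ^ (2 * (m : ℤ) - 1) * 4 ^ (j * N) := by
        rw [h10, show (2 * ((m : ℤ) + ((j * N : ℕ) : ℤ)) - 1) =
          2 * (m : ℤ) - 1 + ((2 * (j * N) : ℕ) : ℤ) by push_cast; ring, zpow_add₀ two_ne_zero,
          zpow_natCast, pow_mul]
        norm_num
      have f3 : (Real.pi : ℂ) ^ (2 * h) = Real.pi ^ (2 * m) * (Real.pi ^ 2) ^ (j * N) := by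
        rw [h10, show (2 * ((m : ℤ) + ((j * N : ℕ) : ℤ))) = ((2 * m + 2 * (j * N) : ℕ) : ℤ) by
          push_cast; ring, zpow_natCast, pow_add, pow_mul _ 2 (j * N)]
      rw [f1, f2, f3, div_pow, mul_pow]
      have g1 : (-1 : ℂ) ^ (j * N) * (-1) ^ (j * N) = 1 := by rw [← mul_pow]; norm_num
      have g2 : ((4 : ℂ) ^ (j * N)) ≠ 0 := pow_ne_zero _ (by norm_num)
      have g3 : (((Real.pi : ℂ) ^ 2) ^ (j * N)) ≠ 0 := pow_ne_zero _ (pow_ne_zero _ hpi)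
      have g4 : ((2 * j).factorial : ℂ) ≠ 0 := by exact_mod_cast Nat.factorial_ne_zero _
      have g5 : ((2 * m).factorial : ℂ) ≠ 0 := by exact_mod_cast Nat.factorial_ne_zero _
      generalize (2 : ℂ) ^ (2 * (m : ℤ) - 1) = A at *
      generalize (-1 : ℂ) ^ (j * N) = B at *
      generalize (4 : ℂ) ^ (j * N) = D at *
      generalize ((Real.pi : ℂ) ^ 2) ^ (j * N) = F at *
      field_simp
      linear_combination (-((bernoulli (2 * j) : ℂ) * A * (bernoulli (2 * m) : ℂ))) * g1
    rw [e2]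
    ring
  · intro i _ j _ hij
    have : (1 - 2 * i : ℝ) = 1 - 2 * j := hij
    exact_mod_cast (by linarith : (i : ℝ) = j)
  · simp only [Finset.mem_singleton]
    exact (s₀_ne_zero hN hNh).symm
  · simp only [Finset.mem_insert, Finset.mem_singleton, not_or]
    exact ⟨one_ne_zero, (s₀_ne_one hN).symm⟩

/-! ### Termwise Mellin inversion and the right line. -/

theorem exists_one_add_abs_pow_mul_exp_le (n : ℕ) {δ : ℝ} (hδ : 0 < δ) :
    ∃ C : ℝ, ∀ t : ℝ, (1 + |t|) ^ n * Real.exp (-δ * |t|) ≤ C := by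
  refine ⟨n.factorial / δ ^ n * Real.exp δ, fun t => ?_⟩
  have h1 := Real.pow_div_factorial_le_exp (δ * (1 + |t|)) (by positivity) n
  have h2 : (0 : ℝ) < n.factorial := by positivity
  rw [div_le_iff₀ h2, mul_pow] at h1
  calc (1 + |t|) ^ n * Real.exp (-δ * |t|)
      = δ ^ n * (1 + |t|) ^ n * (Real.exp (-δ * |t|) / δ ^ n) := by field_simp
    _ ≤ Real.exp (δ * (1 + |t|)) * n.factorial * (Real.exp (-δ * |t|) / δ ^ n) := by gcongr
    _ = n.factorial / δ ^ n * (Real.exp (δ * (1 + |t|)) * Real.exp (-δ * |t|)) := by ring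
    _ = _ := by rw [← Real.exp_add]; congr 2; ring

theorem integrable_of_norm_mul_one_add_abs_pow_le {f : ℝ → ℂ} (hf : Continuous f) {n : ℕ} {C : ℝ}
    (h : ∀ t, ‖f t‖ * (1 + |t|) ^ (n + 2) ≤ C) : Integrable f := by
  refine (integrable_inv_one_add_sq.const_mul C).mono' hf.aestronglyMeasurable
    (Eventually.of_forall fun t => ?_)
  have h1 : (0 : ℝ) < 1 + t ^ 2 := by positivity
  rw [← div_eq_mul_inv, le_div_iff₀ h1]
  refine le_trans ?_ (h t)
  gcongr
  have h2 : 1 + t ^ 2 ≤ (1 + |t|) ^ 2 := by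
    rw [← sq_abs]; nlinarith [abs_nonneg t]
  exact h2.trans (pow_le_pow_right₀ (by linarith [abs_nonneg t]) (by omega))

theorem summable_norm_one_div_nat_add_one_cpow {s : ℂ} (hs : 1 < s.re) :
    Summable fun n : ℕ => ‖1 / ((n : ℂ) + 1) ^ s‖ := by
  have h1 := (summable_nat_add_iff 1).2 (Complex.summable_one_div_nat_cpow.2 hs)
  simpa using h1.norm

theorem hasSum_riemannZeta {s : ℂ} (hs : 1 < s.re) :
    HasSum (fun n : ℕ => 1 / ((n : ℂ) + 1) ^ s) (riemannZeta s) := by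
  rw [zeta_eq_tsum_one_div_nat_add_one_cpow hs]
  exact (summable_norm_one_div_nat_add_one_cpow hs).of_norm.hasSum

theorem exists_norm_riemannZeta_le_of_one_lt {σ : ℝ} (hσ : 1 < σ) :
    ∃ C : ℝ, 0 ≤ C ∧ ∀ s : ℂ, s.re = σ → ‖riemannZeta s‖ ≤ C := by
  refine ⟨∑' n : ℕ, ‖1 / ((n : ℂ) + 1) ^ (σ : ℂ)‖, tsum_nonneg fun _ => norm_nonneg _,
    fun s hs => ?_⟩
  have h1 : ∀ n : ℕ, ‖1 / ((n : ℂ) + 1) ^ s‖ = ‖1 / ((n : ℂ) + 1) ^ (σ : ℂ)‖ := by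
    intro n
    have : ((n : ℂ) + 1) = ((n + 1 : ℝ) : ℂ) := by push_cast; rfl
    rw [this, norm_div, norm_div, norm_cpow_eq_rpow_re_of_pos (by positivity),
      norm_cpow_eq_rpow_re_of_pos (by positivity), hs, ofReal_re]
  rw [zeta_eq_tsum_one_div_nat_add_one_cpow (by rw [hs]; exact hσ)]
  have h2 := summable_norm_one_div_nat_add_one_cpow (s := s) (by rw [hs]; exact hσ)
  exact (norm_tsum_le_tsum_norm h2).trans_eq (tsum_congr h1)

/-- One opening angle `θ < π / 2` for all `p i` bounds every integral of norms by `‖a i‖ ‖p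
i‖^{-(k+1/2)}` times a fixed constant, so sum and integral commute. It serves the right line with `θ
= 0` and the left line with `θ = π(N-1)/(2N)`. -/
theorem hasSum_integral_Gamma_mul {ι : Type*} [Countable ι] (a p : ι → ℂ) (k : ℕ) {θ : ℝ}
    (hθ : θ < Real.pi / 2) (hp : ∀ i, 0 < (p i).re) (hpθ : ∀ i, |arg (p i)| ≤ θ) (F : ℝ → ℂ)
    (hF : ∀ t : ℝ, HasSum (fun i => a i * p i ^ (-(((k + 1 / 2 : ℝ) : ℂ) + t * I))) (F t)) :
    HasSum (fun i => a i * (2 * Real.pi * exp (-p i)))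
      (∫ t : ℝ, Gamma (((k + 1 / 2 : ℝ) : ℂ) + t * I) * F t) := by
  have hp0 : ∀ i, p i ≠ 0 := by
    intro i h0
    have := hp i
    simp [h0] at this
  -- At `t = 0` the exponent is real, so these are the norms of the terms of `hF 0`.
  have hsum : Summable fun i => ‖a i‖ * ‖p i‖ ^ (-(k + 1 / 2 : ℝ)) := by
    refine (hF 0).summable.norm.congr fun i => ?_
    rw [norm_mul, ofReal_zero, zero_mul, add_zero, ← ofReal_neg, norm_cpow_real]
  have hint : ∀ i, Integrable fun t : ℝ => Gamma (((k + 1 / 2 : ℝ) : ℂ) + t * I) *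
      (a i * p i ^ (-(((k + 1 / 2 : ℝ) : ℂ) + t * I))) := by
    intro i
    refine ((integrable_Gamma_mul_cpow k (hp i)).const_mul (a i)).congr (Eventually.of_forall fun t => ?_)
    ring
  have hΓ := integrable_Gamma_mul_exp k hθ
  have hnorm : Summable fun i => ∫ t : ℝ, ‖Gamma (((k + 1 / 2 : ℝ) : ℂ) + t * I) *
      (a i * p i ^ (-(((k + 1 / 2 : ℝ) : ℂ) + t * I)))‖ := by
    refine Summable.of_nonneg_of_le (fun i => integral_nonneg fun t => norm_nonneg _) (fun i => ?_)
      (hsum.mul_right (∫ t : ℝ, ‖Gamma (((k + 1 / 2 : ℝ) : ℂ) + t * I)‖ * Real.exp (θ * |t|)))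
    rw [← integral_const_mul]
    refine integral_mono (hint i).norm (hΓ.const_mul _) fun t => ?_
    simp only [norm_mul]
    calc _ ≤ ‖Gamma (((k + 1 / 2 : ℝ) : ℂ) + t * I)‖ *
          (‖a i‖ * (‖p i‖ ^ (-(k + 1 / 2 : ℝ)) * Real.exp (θ * |t|))) := by
          gcongr
          refine (norm_Gamma_mul_cpow_le k (hp0 i) t).trans ?_
          gcongr
          exact hpθ i
      _ = _ := by ring
  have h1 := hasSum_integral_of_summable_integral_norm hint hnorm
  have h2 : ∀ t : ℝ, ∑' i, Gamma (((k + 1 / 2 : ℝ) : ℂ) + t * I) *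
      (a i * p i ^ (-(((k + 1 / 2 : ℝ) : ℂ) + t * I))) =
      Gamma (((k + 1 / 2 : ℝ) : ℂ) + t * I) * F t := fun t => by
    rw [tsum_mul_left, (hF t).tsum_eq]
  simp_rw [h2] at h1
  refine h1.congr_fun fun i => ?_
  rw [← integral_Gamma_mul_cpow k (hp i), ← integral_const_mul]
  refine integral_congr_ae (Eventually.of_forall fun t => ?_)
  simp only
  ring

theorem ofReal_cpow_eq_exp {y : ℝ} (hy : 0 < y) (z : ℂ) :
    (y : ℂ) ^ z = exp (z * Real.log y) := by
  rw [cpow_def_of_ne_zero (by exact_mod_cast hy.ne'), ofReal_log hy.le, mul_comm]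

theorem hasSum_exp_neg_nat_add_one_mul {y : ℝ} (hy : 0 < y) :
    HasSum (fun m : ℕ => Real.exp (-((m + 1) * y))) (1 / (Real.exp y - 1)) := by
  have h1 : Real.exp (-y) < 1 := by rw [Real.exp_lt_one_iff]; linarith
  have h2 := (hasSum_geometric_of_lt_one (Real.exp_pos _).le h1).mul_left (Real.exp (-y))
  have h3 : Real.exp (-y) * (1 - Real.exp (-y))⁻¹ = 1 / (Real.exp y - 1) := by
    rw [Real.exp_neg]
    have := Real.exp_pos y
    have h4 : Real.exp y - 1 ≠ 0 := by
      have := Real.add_one_lt_exp hy.ne'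
      linarith
    field_simp
  rw [h3] at h2
  refine h2.congr_fun fun m => ?_
  rw [← Real.exp_nat_mul, ← Real.exp_add]
  congr 1; ring

theorem hasSum_lambertTerm_aux {x : ℝ} (hx : 0 < x) {s : ℂ} (hs : 1 < s.re)
    (hs' : 1 < (N * s - N + 2 * h).re) :
    HasSum (fun i : ℕ × ℕ => (((i.1 + 1 : ℝ) ^ ((N : ℤ) - 2 * h) : ℝ) : ℂ) *
      (((i.2 + 1) * ((i.1 + 1) ^ N * x) : ℝ) : ℂ) ^ (-s))
      (riemannZeta s * riemannZeta (N * s - N + 2 * h) * (x : ℂ) ^ (-s)) := by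
  have hsum : Summable fun i : ℕ × ℕ => 1 / ((i.1 : ℂ) + 1) ^ (N * s - N + 2 * h) *
      (1 / ((i.2 : ℂ) + 1) ^ s) :=
    summable_mul_of_summable_norm (f := fun n : ℕ => 1 / ((n : ℂ) + 1) ^ (N * s - N + 2 * h))
      (g := fun n : ℕ => 1 / ((n : ℂ) + 1) ^ s)
      (summable_norm_one_div_nat_add_one_cpow hs') (summable_norm_one_div_nat_add_one_cpow hs)
  have h1 := (HasSum.mul (hasSum_riemannZeta hs') (hasSum_riemannZeta hs) hsum).mul_right
    ((x : ℂ) ^ (-s))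
  rw [mul_comm (riemannZeta (N * s - N + 2 * h))] at h1
  refine h1.congr_fun fun i => ?_
  obtain ⟨n, m⟩ := i
  simp only
  have hn : (0 : ℝ) < n + 1 := by positivity
  have hm : (0 : ℝ) < m + 1 := by positivity
  have e1 : ((n : ℂ) + 1) = ((n + 1 : ℝ) : ℂ) := by push_cast; rfl
  have e2 : ((m : ℂ) + 1) = ((m + 1 : ℝ) : ℂ) := by push_cast; rfl
  have e3 : (((n + 1 : ℝ) ^ ((N : ℤ) - 2 * h) : ℝ) : ℂ) =
      exp (((N : ℂ) - 2 * h) * Real.log (n + 1)) := by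
    rw [← ofReal_cpow_eq_exp hn, ← Real.rpow_intCast, ofReal_cpow hn.le]
    push_cast; rfl
  rw [e1, e2, e3, ofReal_cpow_eq_exp hn, ofReal_cpow_eq_exp hm, ofReal_cpow_eq_exp hx,
    ofReal_cpow_eq_exp (by positivity), Real.log_mul hm.ne' (by positivity),
    Real.log_mul (by positivity) hx.ne', Real.log_pow, one_div, one_div, ← exp_neg, ← exp_neg,
    ← exp_add, ← exp_add, ← exp_add]
  congr 1
  push_cast
  ring

/-- Here `p = m n^N x` with `m, n ≥ 1`. The sum over `m` for fixed `n` is geometric and gives the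
Lambert denominator. -/
theorem hasSum_lambertTerm {x : ℝ} (hx : 0 < x) (k : ℕ) (hk : 1 < (k + 1 / 2 : ℝ))
    (hk' : 1 < N * (k + 1 / 2 : ℝ) - N + 2 * h) :
    HasSum (fun n : ℕ => 2 * Real.pi * (lambertTerm x N h (n + 1) : ℂ))
      (∫ t : ℝ, lambertMellin N h (((k + 1 / 2 : ℝ) : ℂ) + t * I) *
        (x : ℂ) ^ (-(((k + 1 / 2 : ℝ) : ℂ) + t * I))) := by
  have h1 := hasSum_integral_Gamma_mul (ι := ℕ × ℕ) (θ := 0)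
    (fun i => (((i.1 + 1 : ℝ) ^ ((N : ℤ) - 2 * h) : ℝ) : ℂ))
    (fun i => (((i.2 + 1) * ((i.1 + 1) ^ N * x) : ℝ) : ℂ)) k (by positivity)
    (fun i => by rw [ofReal_re]; positivity)
    (fun i => by rw [arg_ofReal_of_nonneg (by positivity), abs_zero]) _
    (fun t => hasSum_lambertTerm_aux hx (by simpa using hk) (by simpa using hk'))
  have h2 := h1.prod_fiberwise (g := fun n : ℕ => 2 * Real.pi * (lambertTerm x N h (n + 1) : ℂ))
    fun n => by
      have hy : 0 < ((n : ℝ) + 1) ^ N * x := by positivity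
      have h3 := ((hasSum_exp_neg_nat_add_one_mul hy).mul_left
        ((n + 1 : ℝ) ^ ((N : ℤ) - 2 * h) * (2 * Real.pi)))
      have h4 := hasSum_ofReal.2 h3
      rw [lambertTerm]
      convert h4 using 1
      · funext m
        push_cast; ring
      · push_cast; ring
  convert h2 using 1
  refine integral_congr_ae (Eventually.of_forall fun t => ?_)
  simp only [lambertMellin]
  ring

/-! ### The functional equation on the left and the finite sum over frequencies. -/

/-- A telescoping geometric sum; it resolves the quotient `sin(Nv) / sin(v)` left by the two
functional equations. -/
theorem sin_mul_sum_exp (N : ℕ) (v : ℂ) :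
    sin v * ∑ r ∈ Finset.range N, exp (I * v * (N - 1 - 2 * r)) = sin (N * v) := by
  have h1 : ∀ r : ℕ, sin v * exp (I * v * (N - 1 - 2 * r)) =
      -(I / 2) * exp (I * v * (N - 2 * r)) - -(I / 2) * exp (I * v * (N - 2 * (r + 1 : ℕ))) := by
    intro r
    have e1 : exp (I * v * (N - 2 * r)) = exp (v * I) * exp (I * v * (N - 1 - 2 * r)) := by
      rw [← exp_add]; congr 1; ring
    have e2 : exp (I * v * (N - 2 * (r + 1 : ℕ))) = exp (-v * I) * exp (I * v * (N - 1 - 2 * r)) := by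
      rw [← exp_add]; congr 1; push_cast; ring
    rw [e1, e2, Complex.sin]; ring
  rw [Finset.mul_sum, Finset.sum_congr rfl fun r _ => h1 r,
    Finset.sum_range_sub' (fun r : ℕ => -(I / 2) * exp (I * v * (N - 2 * r))), Complex.sin]
  have e1 : I * v * (N - 2 * (0 : ℕ)) = N * v * I := by push_cast; ring
  have e2 : I * v * (N - 2 * N) = -(N * v) * I := by ring
  rw [e1, e2]; ring

/-- The frequencies `N-1, N-3, ..., 1-N` pair off as `±l`, and `0` occurs exactly for odd `N`. This
is the origin of the parity split in `F`. -/
theorem sum_range_symm (ψ : ℤ → ℂ) (N : ℕ) :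
    ∑ r ∈ Finset.range N, ψ (N - 1 - 2 * r) =
      if Odd N then ψ 0 + ∑ j ∈ Finset.Icc 1 ((N - 1) / 2), (ψ (2 * j) + ψ (-(2 * j)))
      else ∑ j ∈ Finset.Icc 1 (N / 2), (ψ (2 * j - 1) + ψ (-(2 * j - 1))) := by
  induction N using Nat.twoStepInduction with
  | zero => simp
  | one => simp
  | more N ih _ =>
    rw [Finset.sum_range_succ', Finset.sum_range_succ]
    have e1 : ∑ r ∈ Finset.range N, ψ (((N + 2 : ℕ) : ℤ) - 1 - 2 * ((r + 1 : ℕ) : ℤ)) =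
        ∑ r ∈ Finset.range N, ψ (N - 1 - 2 * r) :=
      Finset.sum_congr rfl fun r _ => by congr 1; push_cast; ring
    rw [e1, ih]
    have hodd : Odd (N + 2) ↔ Odd N := by simp [Nat.odd_add]
    by_cases hN : Odd N
    · rw [if_pos hN, if_pos (hodd.2 hN)]
      obtain ⟨m, rfl⟩ := hN
      have a1 : (2 * m + 1 + 2 - 1) / 2 = m + 1 := by omega
      have a2 : (2 * m + 1 - 1) / 2 = m := by omega
      rw [a1, a2, Finset.sum_Icc_succ_top (by omega)]
      have b1 : (((2 * m + 1 + 2 : ℕ) : ℤ) - 1 - 2 * ((2 * m + 1 + 1 : ℕ) : ℤ)) =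
        -(2 * ((m + 1 : ℕ) : ℤ)) := by push_cast; ring
      have b2 : (((2 * m + 1 + 2 : ℕ) : ℤ) - 1 - 2 * ((0 : ℕ) : ℤ)) = 2 * ((m + 1 : ℕ) : ℤ) := by
        push_cast; ring
      rw [b1, b2]; ring
    · rw [if_neg hN, if_neg (fun h => hN (hodd.1 h))]
      obtain ⟨m, rfl⟩ := (Nat.not_odd_iff_even.1 hN).two_dvd
      have a1 : (2 * m + 2) / 2 = m + 1 := by omega
      have a2 : 2 * m / 2 = m := by omega
      rw [a1, a2, Finset.sum_Icc_succ_top (by omega)]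
      have b1 : (((2 * m + 2 : ℕ) : ℤ) - 1 - 2 * ((2 * m + 1 : ℕ) : ℤ)) =
        -(2 * ((m + 1 : ℕ) : ℤ) - 1) := by push_cast; ring
      have b2 : (((2 * m + 2 : ℕ) : ℤ) - 1 - 2 * ((0 : ℕ) : ℤ)) = 2 * ((m + 1 : ℕ) : ℤ) - 1 := by
        push_cast; ring
      rw [b1, b2]; ring

/-- The two summands are complex conjugates, and `|1 - e^{-(C - iB)}|² = 2 e^{-C} (cosh C - cos B)`
yields the denominator of `f`. -/
theorem re_phase (C B φ : ℝ) (hC : 0 < C) :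
    exp (I * φ) * (exp (-(C - I * B)) / (1 - exp (-(C - I * B)))) +
      exp (-(I * φ)) * (exp (-(C + I * B)) / (1 - exp (-(C + I * B)))) =
      (((Real.cos (B + φ) - Real.exp (-C) * Real.cos φ) / (Real.cosh C - Real.cos B) : ℝ) : ℂ) := by
  have hne : ∀ z : ℂ, z.re = C → 1 - exp (-z) ≠ 0 := by
    intro z hz h0
    have h1 : ‖exp (-z)‖ = 1 := by rw [← sub_eq_zero.1 h0, norm_one]
    rw [Complex.norm_exp, neg_re, hz, Real.exp_eq_one_iff] at h1
    linarith
  have h1 := hne (C - I * B) (by simp)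
  have h2 := hne (C + I * B) (by simp)
  have h3 : Real.cosh C - Real.cos B ≠ 0 := by
    have := Real.one_lt_cosh.2 hC.ne'
    linarith [Real.cos_le_one B]
  have h3' : ((Real.cosh C - Real.cos B : ℝ) : ℂ) ≠ 0 := by exact_mod_cast h3
  rw [ofReal_div, eq_div_iff h3', mul_div_assoc', mul_div_assoc', div_add_div _ _ h1 h2,
    div_mul_eq_mul_div, div_eq_iff (mul_ne_zero h1 h2)]
  push_cast
  rw [Complex.cos, Complex.cos, Complex.cos, Complex.cosh]
  have e1 : exp (-(C - I * B)) = exp (-C) * exp (B * I) := by rw [← exp_add]; congr 1; ring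
  have e2 : exp (-(C + I * B)) = exp (-C) * exp (-B * I) := by rw [← exp_add]; congr 1; ring
  have e3 : exp ((B + φ) * I) = exp (B * I) * exp (φ * I) := by rw [← exp_add]; congr 1; ring
  have e4 : exp (-(B + φ) * I) = exp (-B * I) * exp (-φ * I) := by rw [← exp_add]; congr 1; ring
  have e5 : exp (I * φ) = exp (φ * I) := by congr 1; ring
  have e6 : exp (-(I * φ)) = exp (-φ * I) := by congr 1; ring
  rw [e1, e2, e3, e4, e5, e6]
  have g1 : exp (B * I) * exp (-B * I) = 1 := by rw [← exp_add, ← exp_zero]; congr 1; ring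
  have g2 : exp (C : ℂ) * exp (-C : ℂ) = 1 := by rw [← exp_add, ← exp_zero]; congr 1; ring
  generalize exp (B * I) = b at *
  generalize exp (-B * I) = b' at *
  generalize exp (φ * I) = p at *
  generalize exp (-φ * I) = p' at *
  generalize exp (C : ℂ) = e at *
  generalize exp (-C : ℂ) = e' at *
  obtain rfl : b' = b⁻¹ := eq_inv_of_mul_eq_one_right g1
  obtain rfl : e' = e⁻¹ := eq_inv_of_mul_eq_one_right g2
  have hb : b ≠ 0 := left_ne_zero_of_mul_eq_one g1
  have he : e ≠ 0 := left_ne_zero_of_mul_eq_one g2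
  field_simp
  ring

theorem cos_add_pi_div_two_sub_pi_mul_int (h : ℤ) (y : ℂ) :
    cos (y + Real.pi / 2 - Real.pi * h) = (-1) ^ (h + 1) * sin y := by
  have : y + Real.pi / 2 - Real.pi * h = (y - h * Real.pi) + Real.pi / 2 := by ring
  rw [this, Complex.cos_add_pi_div_two, Complex.sin_sub, Complex.sin_int_mul_pi, zpow_add₀ (by norm_num),
    zpow_one]
  have h1 : cos (h * Real.pi) = (-1) ^ h := by
    have := congrArg (fun r : ℝ => (r : ℂ)) (Real.cos_int_mul_pi h)
    push_cast at this
    exact this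
  rw [h1]
  ring

/-- The equation for `Γ(s) ζ(s)` leaves `2 cos(πs/2) = 2 sin(v)` in the denominator, with `v = π(1 -
s)/2`; the one for `ζ(1 - w)` contributes `2 cos(πw/2) = 2 (-1)^{h+1} sin(Nv)`. A non-integral real
part avoids the poles and the zeros of `sin(v)`. -/
theorem lambertMellin_eq_of_left {s : ℂ}
    (hw : 1 < (N * (1 - s) + 1 - 2 * h).re) (hint : ∀ m : ℤ, s.re ≠ m) :
    lambertMellin N h s = (-1) ^ (h + 1) * (2 * Real.pi : ℂ) ^ (s - (N * (1 - s) + 1 - 2 * h)) *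
      Gamma (N * (1 - s) + 1 - 2 * h) * riemannZeta (N * (1 - s) + 1 - 2 * h) *
      riemannZeta (1 - s) *
      ∑ r ∈ Finset.range N, exp (I * (Real.pi * (1 - s) / 2) * (N - 1 - 2 * r)) := by
  set w := N * (1 - s) + 1 - 2 * h with hwdef
  have hsin : sin (Real.pi * (1 - s) / 2) ≠ 0 := by
    rw [Complex.sin_ne_zero_iff]
    intro k hk
    have hpi : (Real.pi : ℂ) ≠ 0 := by exact_mod_cast Real.pi_pos.ne'
    have h1 : (1 - s) / 2 = k := by
      apply mul_right_cancel₀ hpi; rw [← hk]; ring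
    have h2 : s = ((1 - 2 * k : ℤ) : ℂ) := by push_cast; linear_combination (-2) * h1
    exact hint (1 - 2 * k) (by rw [h2, intCast_re])
  have hcos : cos (Real.pi * s / 2) = sin (Real.pi * (1 - s) / 2) := by
    rw [← Complex.cos_pi_div_two_sub]; congr 1; ring
  have h1 : Gamma s * riemannZeta s = _ := Gamma_mul_riemannZeta_eq
    (fun m hm => hint (-m) (by rw [hm]; simp)) (fun h1 => hint 1 (by rw [h1]; simp))
    (by rwa [hcos])
  have h2 : riemannZeta (1 - w) = _ := riemannZeta_one_sub
    (fun m hm => by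
      rw [hm] at hw
      simp at hw
      linarith [(Nat.cast_nonneg m : (0 : ℝ) ≤ m)])
    (fun h1 => by rw [h1] at hw; simp at hw)
  have h3 : N * s - N + 2 * h = 1 - w := by rw [hwdef]; ring
  have h4 : cos (Real.pi * w / 2) = (-1) ^ (h + 1) * sin (N * (Real.pi * (1 - s) / 2)) := by
    rw [← cos_add_pi_div_two_sub_pi_mul_int]; congr 1; rw [hwdef]; ring
  have hpi : (2 * Real.pi : ℂ) ≠ 0 := by
    exact_mod_cast (by positivity : (2 * Real.pi : ℝ) ≠ 0)
  rw [lambertMellin, h1, h3, h2, h4, ← sin_mul_sum_exp, hcos, sub_eq_add_neg s w, cpow_add _ _ hpi]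
  field_simp

theorem A_pos (N : ℕ) {y : ℝ} (hy : 0 < y) : 0 < A N y := by
  rw [A]; positivity

/-- `exp (i φ) / (exp q - 1)` with `q = 2 A_N(n / x) exp (-π i l / (2N))`, `φ = π (2h - 1) l / (2N)`. -/
noncomputable def phaseSum (N : ℕ) (h : ℤ) (x : ℝ) (n : ℕ) (l : ℤ) : ℂ :=
  exp (I * (Real.pi * (2 * h - 1) * l / (2 * N))) *
    (exp (-(2 * A N (n / x) * exp (-(I * (Real.pi * l / (2 * N)))))) /
      (1 - exp (-(2 * A N (n / x) * exp (-(I * (Real.pi * l / (2 * N))))))))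

theorem phaseSum_zero {x : ℝ} (hx : 0 < x) {n : ℕ} (hn : 0 < n) :
    phaseSum N h x n 0 = (f₀ x n N : ℂ) := by
  have hA : 0 < A N (n / x) := A_pos N (by positivity)
  rw [phaseSum, f₀]
  set y := A N (n / x)
  simp only [Int.cast_zero, mul_zero, zero_div, neg_zero, exp_zero, one_mul, mul_one]
  have h1 : Real.sinh y ≠ 0 := (Real.sinh_pos_iff.2 hA).ne'
  have h2 : (1 : ℝ) - Real.exp (-(2 * y)) ≠ 0 := by
    have : Real.exp (-(2 * y)) < 1 := by rw [Real.exp_lt_one_iff]; linarith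
    linarith
  have h3 : Real.exp (-(2 * y)) / (1 - Real.exp (-(2 * y))) = Real.exp (-y) / (2 * Real.sinh y) := by
    rw [div_eq_div_iff h2 (mul_ne_zero two_ne_zero h1), Real.sinh_eq]
    have e1 : Real.exp (-(2 * y)) = Real.exp (-y) * Real.exp (-y) := by
      rw [← Real.exp_add]; congr 1; ring
    have e2 : Real.exp (-y) * Real.exp y = 1 := by rw [← Real.exp_add]; simp
    rw [e1]; linear_combination Real.exp (-y) * e2
  rw [← h3]
  push_cast
  rfl

theorem phaseSum_add_phaseSum_neg {x : ℝ} (hx : 0 < x) {n : ℕ} (hn : 0 < n) {j : ℕ} (hj : j < N) :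
    phaseSum N h x n j + phaseSum N h x n (-j) = (f j x n N h : ℂ) := by
  have hA : 0 < A N (n / x) := A_pos N (by positivity)
  have hN : 0 < (N : ℝ) := by exact_mod_cast (by omega : 0 < N)
  -- As `j < N`, the angle is below `π / 2`; this positivity keeps the denominators in `re_phase`
  -- nonzero.
  have hcos : 0 < a j N := by
    refine Real.cos_pos_of_mem_Ioo ⟨?_, ?_⟩
    · have : 0 ≤ Real.pi * j / (2 * N) := by positivity
      linarith [Real.pi_pos]
    · rw [div_lt_div_iff₀ (by positivity) two_pos]
      have : (j : ℝ) < N := by exact_mod_cast hj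
      nlinarith [Real.pi_pos]
  have h1 := re_phase (2 * A N (n / x) * a j N) (2 * A N (n / x) * b j N)
    (Real.pi * (2 * h - 1) * j / (2 * N)) (by positivity)
  have e1 : exp (-(I * (Real.pi * ((j : ℤ) : ℂ) / (2 * N)))) = a j N - I * b j N := by
    rw [a, b, show -(I * (Real.pi * ((j : ℤ) : ℂ) / (2 * N))) =
      ((-(Real.pi * j / (2 * N)) : ℝ) : ℂ) * I by push_cast; ring, exp_mul_I, ← ofReal_cos,
      ← ofReal_sin, Real.cos_neg, Real.sin_neg]
    push_cast; ring
  have e2 : exp (-(I * (Real.pi * ((-j : ℤ) : ℂ) / (2 * N)))) = a j N + I * b j N := by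
    rw [a, b, show -(I * (Real.pi * ((-j : ℤ) : ℂ) / (2 * N))) =
      ((Real.pi * j / (2 * N) : ℝ) : ℂ) * I by push_cast; ring, exp_mul_I, ← ofReal_cos,
      ← ofReal_sin]
    ring
  rw [phaseSum, phaseSum, e1, e2, f]
  convert h1 using 2
  · congr 1
    · congr 1; push_cast; ring
    · congr 2
      · push_cast; ring
      · congr 2; push_cast; ring
  · congr 1
    · congr 1; push_cast; ring
    · congr 2
      · push_cast; ring
      · congr 2; push_cast; ring
  · ring_nf

theorem sTerm_eq {x : ℝ} (hx : 0 < x) {n : ℕ} (hn : 0 < n) (hN : 0 < N) :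
    (sTerm x N h n : ℂ) = ((1 / (n : ℝ) ^ ((2 * (h : ℝ) - 1) / N) : ℝ) : ℂ) *
      ∑ r ∈ Finset.range N, phaseSum N h x n (N - 1 - 2 * r) := by
  rw [sum_range_symm, sTerm, ofReal_mul]
  congr 1
  split_ifs with hodd
  · rw [phaseSum_zero hx hn]
    push_cast
    congr 1
    refine Finset.sum_congr rfl fun j hj => ?_
    have hj := Finset.mem_Icc.1 hj
    rw [← phaseSum_add_phaseSum_neg hx hn (by omega)]
    push_cast; rfl
  · push_cast
    refine Finset.sum_congr rfl fun j hj => ?_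
    have hj := Finset.mem_Icc.1 hj
    rw [← phaseSum_add_phaseSum_neg hx hn (by omega), Nat.cast_sub (by omega)]
    push_cast; rfl

theorem log_ofReal_mul_exp {y α : ℝ} (hy : 0 < y) (hα : |α| < Real.pi) :
    log ((y : ℂ) * exp (-(I * α))) = Real.log y - I * α := by
  have h1 : (y : ℂ) = exp (Real.log y) := by rw [← ofReal_exp, Real.exp_log hy]
  have hα' := abs_lt.1 hα
  nth_rewrite 1 [h1]
  rw [← exp_add, log_exp, sub_eq_add_neg]
  · simp; linarith
  · simp; linarith

/-! ### Expansion of the left integral into the terms of `S`. -/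

/-- The factor of `Γ(w)` in the summand of `lambertMellin` on the left of its poles. -/
noncomputable def leftKernel (N : ℕ) (h : ℤ) (x : ℝ) (l : ℤ) (w : ℂ) : ℂ :=
  riemannZeta ((w + 2 * h - 1) / N) * riemannZeta w *
    exp (-w * Real.log (2 * Real.pi) - w / N * Real.log (2 * Real.pi / x) +
      I * (Real.pi * ((w + 2 * h - 1) / N) / 2) * l)

/-- With `u = (w + 2h - 1)/N`, the product `n^{-u} m^{-w}` regroups as `n^{-(2h-1)/N} (m
n^{1/N})^{-w}`. The factor `e^{ivl}`, where `v = πu/2`, splits into the constant phase and the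
rotation of the base by `e^{-iπl/(2N)}`. -/
theorem hasSum_left_aux {x : ℝ} (hx : 0 < x) (hN : 0 < N) {l : ℤ} (hl : |(l : ℝ)| ≤ N - 1) {w : ℂ}
    (hw : 1 < w.re) (hu : 1 < ((w + 2 * h - 1) / N).re) :
    HasSum (fun i : ℕ × ℕ =>
      ((1 / ((i.1 + 1 : ℕ) : ℝ) ^ ((2 * (h : ℝ) - 1) / N) : ℝ) : ℂ) *
        exp (I * (Real.pi * (2 * h - 1) * l / (2 * N))) *
      ((((i.2 + 1) * (2 * A N ((i.1 + 1 : ℕ) / x)) : ℝ) : ℂ) *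
        exp (-(I * (Real.pi * l / (2 * N) : ℝ)))) ^ (-w))
      (leftKernel N h x l w) := by
  have hN' : (0 : ℝ) < N := by exact_mod_cast hN
  have hNc : (N : ℂ) ≠ 0 := by exact_mod_cast hN.ne'
  have hsum : Summable fun i : ℕ × ℕ => 1 / ((i.1 : ℂ) + 1) ^ ((w + 2 * h - 1) / N) *
      (1 / ((i.2 : ℂ) + 1) ^ w) :=
    summable_mul_of_summable_norm (f := fun n : ℕ => 1 / ((n : ℂ) + 1) ^ ((w + 2 * h - 1) / N))
      (g := fun n : ℕ => 1 / ((n : ℂ) + 1) ^ w)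
      (summable_norm_one_div_nat_add_one_cpow hu) (summable_norm_one_div_nat_add_one_cpow hw)
  have h1 := (HasSum.mul (hasSum_riemannZeta hu) (hasSum_riemannZeta hw) hsum).mul_right
    (exp (-w * Real.log (2 * Real.pi) - w / N * Real.log (2 * Real.pi / x) +
          I * (Real.pi * ((w + 2 * h - 1) / N) / 2) * l))
  refine h1.congr_fun fun i => ?_
  obtain ⟨n, m⟩ := i
  simp only
  have hn : (0 : ℝ) < n + 1 := by positivity
  have hm : (0 : ℝ) < m + 1 := by positivity
  have hA : 0 < A N ((n + 1 : ℕ) / x) := A_pos N (by positivity)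
  have e1 : ((n : ℂ) + 1) = ((n + 1 : ℝ) : ℂ) := by push_cast; rfl
  have e2 : ((m : ℂ) + 1) = ((m + 1 : ℝ) : ℂ) := by push_cast; rfl
  -- Keeps the rotated base within the principal branch, so that its logarithm splits.
  have hα : |Real.pi * l / (2 * N)| < Real.pi := by
    rw [abs_div, abs_mul, abs_of_pos Real.pi_pos, abs_of_pos (by positivity : (0 : ℝ) < 2 * N),
      div_lt_iff₀ (by positivity)]
    nlinarith [Real.pi_pos]
  have e3 : ((1 / ((n + 1 : ℕ) : ℝ) ^ ((2 * (h : ℝ) - 1) / N) : ℝ) : ℂ) =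
      exp (-((2 * h - 1) / N * Real.log (n + 1))) := by
    rw [Nat.cast_succ, Real.rpow_def_of_pos hn, one_div, ← Real.exp_neg]
    push_cast; ring_nf
  have e4 : Real.log ((m + 1) * (2 * A N ((n + 1 : ℕ) / x))) = Real.log (m + 1) +
      Real.log (2 * Real.pi) + (Real.log (n + 1) + Real.log (2 * Real.pi / x)) / N := by
    have e5 : Real.log (2 * Real.pi * (((n + 1 : ℕ) : ℝ) / x)) =
        Real.log (n + 1) + Real.log (2 * Real.pi / x) := by
      rw [← Real.log_mul (by positivity) (by positivity)]
      congr 1; push_cast; ring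
    rw [Real.log_mul hm.ne' (by positivity), A, ← mul_assoc, Real.log_mul (by positivity)
      (by positivity), Real.log_rpow (by positivity), e5]
    ring
  rw [cpow_def_of_ne_zero (mul_ne_zero (by
      exact_mod_cast (by positivity : ((m : ℝ) + 1) * (2 * A N ((n + 1 : ℕ) / x)) ≠ 0))
      (exp_ne_zero _)), log_ofReal_mul_exp (by positivity) hα, e4, e1, e2, e3,
    ofReal_cpow_eq_exp hn, ofReal_cpow_eq_exp hm, one_div, one_div, ← exp_neg, ← exp_neg,
    ← exp_add, ← exp_add, ← exp_add, ← exp_add]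
  congr 1
  push_cast
  field_simp
  ring

theorem hasSum_exp_neg_nat_add_one_mul_complex {q : ℂ} (hq : 0 < q.re) :
    HasSum (fun m : ℕ => exp (-((m + 1) * q))) (exp (-q) / (1 - exp (-q))) := by
  have h1 : ‖exp (-q)‖ < 1 := by
    rw [Complex.norm_exp, Real.exp_lt_one_iff, neg_re]; linarith
  have h2 := (hasSum_geometric_of_norm_lt_one h1).mul_left (exp (-q))
  rw [← div_eq_mul_inv] at h2
  refine h2.congr_fun fun m => ?_
  rw [← exp_nat_mul, ← exp_add]
  congr 1; ring

/-- The bound `|l| ≤ N - 1` keeps all bases in the sector of half-angle `π(N-1)/(2N)`, inside the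
right half-plane; the sum over `m` is then a convergent geometric series. -/
theorem hasSum_phaseSum {x : ℝ} (hx : 0 < x) (hN : 0 < N) {l : ℤ} (hl : |(l : ℝ)| ≤ N - 1) (k : ℕ)
    (hk : 1 < (k + 1 / 2 : ℝ)) (hk' : 1 < (k + 1 / 2 + 2 * h - 1 : ℝ) / N) :
    HasSum (fun n : ℕ => 2 * Real.pi *
      (((1 / ((n + 1 : ℕ) : ℝ) ^ ((2 * (h : ℝ) - 1) / N) : ℝ) : ℂ) * phaseSum N h x (n + 1) l))
      (∫ t : ℝ, Gamma (((k + 1 / 2 : ℝ) : ℂ) + t * I) *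
        leftKernel N h x l (((k + 1 / 2 : ℝ) : ℂ) + t * I)) := by
  have hN' : (0 : ℝ) < N := by exact_mod_cast hN
  have hα : |Real.pi * l / (2 * N)| ≤ Real.pi * (N - 1) / (2 * N) := by
    rw [abs_div, abs_mul, abs_of_pos Real.pi_pos, abs_of_pos (by positivity : (0 : ℝ) < 2 * N)]
    gcongr
  have hθ : Real.pi * (N - 1) / (2 * N) < Real.pi / 2 := by
    rw [div_lt_div_iff₀ (by positivity) two_pos]
    nlinarith [Real.pi_pos]
  have hcos : 0 < Real.cos (Real.pi * l / (2 * N)) :=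
    Real.cos_pos_of_mem_Ioo (abs_lt.1 (hα.trans_lt hθ))
  have hexp : (exp (-(I * (Real.pi * l / (2 * N) : ℝ)))).re = Real.cos (Real.pi * l / (2 * N)) := by
    rw [show -(I * ((Real.pi * l / (2 * N) : ℝ) : ℂ)) = ((-(Real.pi * l / (2 * N)) : ℝ) : ℂ) * I by
      push_cast; ring, exp_ofReal_mul_I_re, Real.cos_neg]
  have hApos : ∀ n : ℕ, 0 < 2 * A N ((n + 1 : ℕ) / x) := fun n => by
    have := A_pos N (y := (n + 1 : ℕ) / x) (by positivity)
    positivity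
  have h1 := hasSum_integral_Gamma_mul (ι := ℕ × ℕ) (θ := Real.pi * (N - 1) / (2 * N))
    (fun i => ((1 / ((i.1 + 1 : ℕ) : ℝ) ^ ((2 * (h : ℝ) - 1) / N) : ℝ) : ℂ) *
        exp (I * (Real.pi * (2 * h - 1) * l / (2 * N))))
    (fun i => (((i.2 + 1) * (2 * A N ((i.1 + 1 : ℕ) / x)) : ℝ) : ℂ) *
        exp (-(I * (Real.pi * l / (2 * N) : ℝ)))) k hθ
    (fun i => by
      rw [re_ofReal_mul, hexp]
      have := hApos i.1
      positivity)
    (fun i => by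
      have := hApos i.1
      rw [← log_im, log_ofReal_mul_exp (by positivity) ((hα.trans_lt hθ).trans (by
        linarith [Real.pi_pos]))]
      rw [sub_im, ofReal_im, I_mul_im, ofReal_re, zero_sub, abs_neg]
      exact hα) _
    (fun t => hasSum_left_aux hx hN hl (by simpa using hk) (by
      have : ((((k + 1 / 2 : ℝ) : ℂ) + t * I + 2 * h - 1) / N).re = (k + 1 / 2 + 2 * h - 1 : ℝ) / N := by
        rw [Complex.div_natCast_re]; simp
      rwa [this]))
  refine h1.prod_fiberwise fun n => ?_
  have hq : 0 < (2 * A N ((n + 1 : ℕ) / x) * exp (-(I * (Real.pi * l / (2 * N)))) : ℂ).re := by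
    have e1 : (2 * A N ((n + 1 : ℕ) / x) * exp (-(I * (Real.pi * l / (2 * N)))) : ℂ) =
      ((2 * A N ((n + 1 : ℕ) / x) : ℝ) : ℂ) * exp (-(I * (Real.pi * l / (2 * N) : ℝ))) := by
        push_cast; rfl
    rw [e1, re_ofReal_mul, hexp]
    exact mul_pos (hApos n) hcos
  have h3 := (hasSum_exp_neg_nat_add_one_mul_complex hq).mul_left
    (((1 / ((n + 1 : ℕ) : ℝ) ^ ((2 * (h : ℝ) - 1) / N) : ℝ) : ℂ) *
        exp (I * (Real.pi * (2 * h - 1) * l / (2 * N))) * (2 * Real.pi))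
  have hval : 2 * (Real.pi : ℂ) * (((1 / ((n + 1 : ℕ) : ℝ) ^ ((2 * (h : ℝ) - 1) / N) : ℝ) : ℂ) *
      phaseSum N h x (n + 1) l) = _ :=
    (by rw [phaseSum]; ring : _ = ((1 / ((n + 1 : ℕ) : ℝ) ^ ((2 * (h : ℝ) - 1) / N) : ℝ) : ℂ) *
        exp (I * (Real.pi * (2 * h - 1) * l / (2 * N))) * (2 * Real.pi) *
      (exp (-(2 * A N ((n + 1 : ℕ) / x) * exp (-(I * (Real.pi * l / (2 * N)))))) /
      (1 - exp (-(2 * A N ((n + 1 : ℕ) / x) * exp (-(I * (Real.pi * l / (2 * N)))))))))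
  rw [hval]
  refine h3.congr_fun fun m => ?_
  rw [mul_assoc _ (2 * (Real.pi : ℂ))]
  congr 4
  push_cast; ring

theorem continuous_Gamma_vertical (k : ℕ) :
    Continuous fun t : ℝ => Gamma (((k + 1 / 2 : ℝ) : ℂ) + t * I) := by
  refine continuous_iff_continuousAt.2 fun t => ?_
  refine ContinuousAt.comp (f := fun t : ℝ => ((k + 1 / 2 : ℝ) : ℂ) + t * I)
    (differentiableAt_Gamma _ fun m hm => ?_).continuousAt (by fun_prop)
  have := congrArg re hm
  simp at this
  have h' : (0 : ℝ) < k + 2⁻¹ := by positivity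
  linarith [(Nat.cast_nonneg m : (0 : ℝ) ≤ m)]

theorem continuous_leftKernel (hN : 0 < N) (x : ℝ) (l : ℤ) {κ : ℝ} (hk : 1 < κ)
    (hk' : 1 < (κ + 2 * h - 1) / N) :
    Continuous fun t : ℝ => leftKernel N h x l (κ + t * I) := by
  have hNc : (N : ℂ) ≠ 0 := by exact_mod_cast hN.ne'
  unfold leftKernel
  refine ((continuous_iff_continuousAt.2 fun t => ?_).mul
    (continuous_iff_continuousAt.2 fun t => ?_)).mul ?_
  · refine ContinuousAt.comp (f := fun t : ℝ => (((κ : ℂ) + t * I) + 2 * h - 1) / N)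
      (differentiableAt_riemannZeta fun h1 => ?_).continuousAt (by fun_prop)
    have := congrArg re h1
    rw [Complex.div_natCast_re] at this
    simp at this
    linarith
  · refine ContinuousAt.comp (f := fun t : ℝ => ((κ : ℂ) + t * I))
      (differentiableAt_riemannZeta fun h1 => ?_).continuousAt (by fun_prop)
    have := congrArg re h1
    simp at this
    linarith
  · fun_prop

theorem exists_norm_leftKernel_le (hN : 0 < N) (x : ℝ) {l : ℤ} (hl : |(l : ℝ)| ≤ N - 1) {κ : ℝ}
    (hk : 1 < κ) (hk' : 1 < (κ + 2 * h - 1) / N) :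
    ∃ C : ℝ, 0 ≤ C ∧ ∀ t : ℝ, ‖leftKernel N h x l (κ + t * I)‖ ≤
      C * Real.exp (Real.pi * (N - 1) / (2 * N) * |t|) := by
  obtain ⟨C₁, hC₁, h1⟩ := exists_norm_riemannZeta_le_of_one_lt hk
  obtain ⟨C₂, hC₂, h2⟩ := exists_norm_riemannZeta_le_of_one_lt hk'
  have hN' : (0 : ℝ) < N := by exact_mod_cast hN
  have hNc : (N : ℂ) ≠ 0 := by exact_mod_cast hN.ne'
  refine ⟨C₂ * C₁ * Real.exp (-κ * Real.log (2 * Real.pi) - κ / N * Real.log (2 * Real.pi / x)),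
    by positivity, fun t => ?_⟩
  rw [leftKernel, norm_mul, norm_mul, Complex.norm_exp, mul_assoc (C₂ * C₁), ← Real.exp_add]
  have e1 : (-(κ + t * I : ℂ) * Real.log (2 * Real.pi) -
      (κ + t * I) / N * Real.log (2 * Real.pi / x) +
      I * (Real.pi * ((κ + t * I + 2 * h - 1) / N) / 2) * l) =
      ((-κ * Real.log (2 * Real.pi) - κ / N * Real.log (2 * Real.pi / x) -
        Real.pi * t / (2 * N) * l : ℝ) : ℂ) +
      ((-t * Real.log (2 * Real.pi) - t / N * Real.log (2 * Real.pi / x) +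
        Real.pi * (κ + 2 * h - 1) / (2 * N) * l : ℝ) : ℂ) * I := by
    push_cast
    field_simp
    ring_nf
    rw [I_sq]
    ring
  rw [e1, re_add_im_eq]
  gcongr
  · exact h2 _ (by rw [Complex.div_natCast_re]; simp)
  · exact h1 _ (by simp)
  · rw [sub_eq_add_neg]
    gcongr
    calc -(Real.pi * t / (2 * N) * l) ≤ |Real.pi * t / (2 * N) * l| := neg_le_abs _
      _ = Real.pi * |l| / (2 * N) * |t| := by
        rw [abs_mul, abs_div, abs_mul, abs_of_pos Real.pi_pos,
          abs_of_pos (by positivity : (0 : ℝ) < 2 * N)]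
        push_cast; ring
      _ ≤ _ := by
        push_cast
        gcongr
where
  re_add_im_eq {a b : ℝ} : ((a : ℂ) + (b : ℂ) * I).re = a := by simp

/-- The decay rate `π/2` of `Γ` exceeds the growth rate `π(N-1)/(2N)` of the kernel by `π/(2N)`,
which absorbs any polynomial. -/
theorem exists_norm_Gamma_mul_leftKernel_le (hN : 0 < N) (x : ℝ) {l : ℤ} (hl : |(l : ℝ)| ≤ N - 1)
    (k : ℕ) (hk : 1 < (k + 1 / 2 : ℝ)) (hk' : 1 < (k + 1 / 2 + 2 * h - 1 : ℝ) / N) (n : ℕ) :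
    ∃ C : ℝ, ∀ t : ℝ, ‖Gamma (((k + 1 / 2 : ℝ) : ℂ) + t * I) *
      leftKernel N h x l (((k + 1 / 2 : ℝ) : ℂ) + t * I)‖ * (1 + |t|) ^ n ≤ C := by
  obtain ⟨C₁, hC₁, h1⟩ := exists_norm_Gamma_half_add_nat_le k
  obtain ⟨C₂, hC₂, h2⟩ := exists_norm_leftKernel_le hN x hl hk hk'
  have hN' : (0 : ℝ) < N := by exact_mod_cast hN
  have hδ : 0 < Real.pi / (2 * N) := by positivity
  obtain ⟨C₃, h3⟩ := exists_one_add_abs_pow_mul_exp_le (k + n) hδ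
  refine ⟨C₁ * C₂ * C₃, fun t => ?_⟩
  rw [norm_mul]
  calc _ ≤ (C₁ * (1 + |t|) ^ k * Real.exp (-(Real.pi / 2) * |t|)) *
        (C₂ * Real.exp (Real.pi * (N - 1) / (2 * N) * |t|)) * (1 + |t|) ^ n := by
        gcongr
        · exact h1 t
        · exact h2 t
    _ = C₁ * C₂ * ((1 + |t|) ^ (k + n) * (Real.exp (-(Real.pi / 2) * |t|) *
        Real.exp (Real.pi * (N - 1) / (2 * N) * |t|))) := by rw [pow_add]; ring
    _ = C₁ * C₂ * ((1 + |t|) ^ (k + n) * Real.exp (-(Real.pi / (2 * N)) * |t|)) := by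
        rw [← Real.exp_add]
        congr 3
        field_simp
        ring
    _ ≤ _ := by gcongr; exact h3 t

theorem abs_sub_one_sub_two_mul_le {r : ℕ} (hr : r < N) :
    |(((N : ℤ) - 1 - 2 * r : ℤ) : ℝ)| ≤ N - 1 := by
  have : (r : ℝ) + 1 ≤ N := by exact_mod_cast hr
  push_cast
  rw [abs_le]
  constructor <;> linarith [(Nat.cast_nonneg r : (0 : ℝ) ≤ r)]

/-- The integrand on the left line, in the variable `w = N (1 - s) + 1 - 2h`. -/
noncomputable def leftIntegrand (N : ℕ) (h : ℤ) (x : ℝ) (w : ℂ) : ℂ :=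
  Gamma w * ∑ r ∈ Finset.range N, leftKernel N h x (N - 1 - 2 * r) w

theorem exists_norm_leftIntegrand_le (hN : 0 < N) (x : ℝ)
    (k : ℕ) (hk : 1 < (k + 1 / 2 : ℝ)) (hk' : 1 < (k + 1 / 2 + 2 * h - 1 : ℝ) / N) (n : ℕ) :
    ∃ C : ℝ, ∀ t : ℝ,
      ‖leftIntegrand N h x (((k + 1 / 2 : ℝ) : ℂ) + t * I)‖ * (1 + |t|) ^ n ≤ C := by
  choose! C hC using fun (r : ℕ) (hr : r < N) => exists_norm_Gamma_mul_leftKernel_le (h := h) hN x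
    (abs_sub_one_sub_two_mul_le hr) k hk hk' n
  refine ⟨∑ r ∈ Finset.range N, C r, fun t => ?_⟩
  rw [leftIntegrand, Finset.mul_sum]
  refine (mul_le_mul_of_nonneg_right (norm_sum_le _ _) (by positivity)).trans ?_
  rw [Finset.sum_mul]
  exact Finset.sum_le_sum fun r hr => hC r (Finset.mem_range.1 hr) t

theorem hasSum_sTerm {x : ℝ} (hx : 0 < x) (hN : 0 < N) (k : ℕ) (hk : 1 < (k + 1 / 2 : ℝ))
    (hk' : 1 < (k + 1 / 2 + 2 * h - 1 : ℝ) / N) :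
    HasSum (fun n : ℕ => 2 * Real.pi * (sTerm x N h (n + 1) : ℂ))
      (∫ t : ℝ, leftIntegrand N h x (((k + 1 / 2 : ℝ) : ℂ) + t * I)) := by
  have h1 := hasSum_sum (s := Finset.range N) fun r hr =>
    hasSum_phaseSum (h := h) hx hN (abs_sub_one_sub_two_mul_le (Finset.mem_range.1 hr)) k hk hk'
  rw [← integral_finsetSum] at h1
  · convert h1 using 1
    · funext n
      rw [sTerm_eq hx n.succ_pos hN, Finset.mul_sum, Finset.mul_sum]
    · simp only [leftIntegrand, Finset.mul_sum]
  · intro r hr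
    obtain ⟨C, hC⟩ := exists_norm_Gamma_mul_leftKernel_le (h := h) hN x
      (abs_sub_one_sub_two_mul_le (Finset.mem_range.1 hr)) k hk hk' (0 + 2)
    exact integrable_of_norm_mul_one_add_abs_pow_le
      ((continuous_Gamma_vertical k).mul (continuous_leftKernel hN x _ hk hk')) hC

/-- The powers match because `s = s₀ - w/N`, whence `(2π)^{s-w} x^{-s} = (2π/x)^{s₀} (2π)^{-w}
(2π/x)^{-w/N}`. -/
theorem lambertMellin_mul_cpow_eq_leftIntegrand {x : ℝ} (hx : 0 < x) (hN : 0 < N) {s : ℂ}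
    (hw : 1 < (N * (1 - s) + 1 - 2 * h).re) (hint : ∀ m : ℤ, s.re ≠ m) :
    lambertMellin N h s * (x : ℂ) ^ (-s) =
      (-1) ^ (h + 1) * (((2 * Real.pi / x) ^ (s₀ N h) : ℝ) : ℂ) *
        leftIntegrand N h x (N * (1 - s) + 1 - 2 * h) := by
  have hNc : (N : ℂ) ≠ 0 := by exact_mod_cast hN.ne'
  rw [lambertMellin_eq_of_left hw hint, leftIntegrand]
  have e0 : (N * (1 - s) + 1 - 2 * h + 2 * h - 1) / N = 1 - s := by field_simp; ring
  simp only [leftKernel, e0]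
  rw [Finset.mul_sum, Finset.sum_mul, Finset.mul_sum, Finset.mul_sum]
  refine Finset.sum_congr rfl fun r _ => ?_
  have e1 : (2 * Real.pi : ℂ) = ((2 * Real.pi : ℝ) : ℂ) := by push_cast; rfl
  rw [e1, ofReal_cpow_eq_exp (by positivity), ofReal_cpow_eq_exp hx,
    ofReal_cpow (by positivity), ofReal_cpow_eq_exp (by positivity), exp_add]
  have e2 : exp ((s - (N * (1 - s) + 1 - 2 * h)) * Real.log (2 * Real.pi)) *
      exp (-s * Real.log x) = exp ((s₀ N h : ℂ) * Real.log (2 * Real.pi / x)) *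
      exp (-(N * (1 - s) + 1 - 2 * h) * Real.log (2 * Real.pi) -
        (N * (1 - s) + 1 - 2 * h) / N * Real.log (2 * Real.pi / x)) := by
    rw [← exp_add, ← exp_add, Real.log_div (by positivity) hx.ne', s₀]
    congr 1
    push_cast
    field_simp
    ring
  have e3 : exp (I * (Real.pi * (1 - s) / 2) * (N - 1 - 2 * r)) =
      exp (I * (Real.pi * (1 - s) / 2) * (((N : ℤ) - 1 - 2 * r : ℤ) : ℂ)) := by
    push_cast; rfl
  rw [e3]
  linear_combination ((-1) ^ (h + 1) * Gamma (N * (1 - s) + 1 - 2 * h) *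
    riemannZeta (N * (1 - s) + 1 - 2 * h) * riemannZeta (1 - s) *
    exp (I * (Real.pi * (1 - s) / 2) * (((N : ℤ) - 1 - 2 * r : ℤ) : ℂ))) * e2

/-! ### Edge bounds and the contour shift. -/

theorem analyticAt_lambertMellin (hN : 0 < N) {s : ℂ} (hs : ∀ m : ℕ, s ≠ -m) (h1 : s ≠ 1)
    (h2 : s ≠ (s₀ N h : ℂ)) : AnalyticAt ℂ (lambertMellin N h) s :=
  ((analyticAt_Gamma hs).mul (analyticAt_riemannZeta h1)).mul (analyticAt_riemannZeta_comp hN h2)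

theorem analyticAt_ofReal_cpow_neg {x : ℝ} (hx : 0 < x) (s : ℂ) :
    AnalyticAt ℂ (fun z : ℂ => (x : ℂ) ^ (-z)) s :=
  AnalyticAt.cpow analyticAt_const (by fun_prop) (Or.inl (by simpa using hx))

theorem exists_norm_lambertMellin_right_le {x : ℝ} (hx : 0 < x) (k : ℕ)
    (hk : 1 < (k + 1 / 2 : ℝ)) (hk' : 1 < N * (k + 1 / 2 : ℝ) - N + 2 * h) (n : ℕ) :
    ∃ C : ℝ, ∀ s : ℂ, s.re = k + 1 / 2 →
      ‖lambertMellin N h s * (x : ℂ) ^ (-s)‖ * (1 + |s.im|) ^ n ≤ C := by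
  obtain ⟨C₁, hC₁, h1⟩ := exists_norm_Gamma_half_add_nat_le k
  obtain ⟨C₂, hC₂, h2⟩ := exists_norm_riemannZeta_le_of_one_lt hk
  obtain ⟨C₃, hC₃, h3⟩ := exists_norm_riemannZeta_le_of_one_lt hk'
  obtain ⟨C₄, h4⟩ := exists_one_add_abs_pow_mul_exp_le (k + n) (half_pos Real.pi_pos)
  refine ⟨C₁ * C₂ * C₃ * x ^ (-(k + 1 / 2 : ℝ)) * C₄, fun s hs => ?_⟩
  have hs' : s = ((k + 1 / 2 : ℝ) : ℂ) + s.im * I := by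
    rw [← hs, re_add_im]
  have e1 : ‖Gamma s‖ ≤ C₁ * (1 + |s.im|) ^ k * Real.exp (-(Real.pi / 2) * |s.im|) := by
    have := h1 s.im
    rwa [← hs'] at this
  have e3 : ‖riemannZeta (N * s - N + 2 * h)‖ ≤ C₃ := h3 _ (by simp [hs])
  rw [lambertMellin, norm_mul, norm_mul, norm_mul, norm_cpow_eq_rpow_re_of_pos hx, neg_re, hs]
  calc _ ≤ ((C₁ * (1 + |s.im|) ^ k * Real.exp (-(Real.pi / 2) * |s.im|)) * C₂ * C₃ *
        x ^ (-(k + 1 / 2 : ℝ))) * (1 + |s.im|) ^ n := by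
        gcongr
        exact h2 s hs
    _ = C₁ * C₂ * C₃ * x ^ (-(k + 1 / 2 : ℝ)) *
        ((1 + |s.im|) ^ (k + n) * Real.exp (-(Real.pi / 2) * |s.im|)) := by rw [pow_add]; ring
    _ ≤ _ := by gcongr; exact h4 _

/-- The abscissa of the left line of integration. -/
noncomputable def leftAbscissa (N : ℕ) (h : ℤ) (k : ℕ) : ℝ := 1 - (k + 1 / 2 + 2 * h - 1) / N

/-- Parity again: after doubling, an even number would equal an odd one. Hence the left line avoids
the integers. -/
theorem leftAbscissa_ne_int (hN : 0 < N) (k : ℕ) (m : ℤ) : leftAbscissa N h k ≠ m := by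
  intro h1
  have hN' : (N : ℝ) ≠ 0 := by positivity
  rw [leftAbscissa, sub_eq_iff_eq_add, ← sub_eq_iff_eq_add', eq_div_iff hN'] at h1
  have h2 : (1 - m) * (N : ℤ) * 2 = 2 * k + 1 + 4 * h - 2 := by
    have : (1 - m) * (N : ℝ) * 2 = 2 * k + 1 + 4 * h - 2 := by linear_combination 2 * h1
    exact_mod_cast this
  omega

theorem left_change_of_variable (hN : 0 < N) (k : ℕ) {s : ℂ} (hs : s.re = leftAbscissa N h k) :
    N * (1 - s) + 1 - 2 * h = ((k + 1 / 2 : ℝ) : ℂ) + ((-N * s.im : ℝ) : ℂ) * I := by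
  have hN' : (N : ℂ) ≠ 0 := by exact_mod_cast hN.ne'
  have h1 : s = (leftAbscissa N h k : ℂ) + s.im * I := by rw [← hs, re_add_im]
  generalize s.im = t at *
  rw [h1, leftAbscissa]
  push_cast
  field_simp
  ring

theorem lambertMellin_mul_cpow_left {x : ℝ} (hx : 0 < x) (hN : 0 < N) (k : ℕ)
    (hk : 1 < (k + 1 / 2 : ℝ)) {s : ℂ} (hs : s.re = leftAbscissa N h k) :
    lambertMellin N h s * (x : ℂ) ^ (-s) =
      (-1) ^ (h + 1) * (((2 * Real.pi / x) ^ (s₀ N h) : ℝ) : ℂ) *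
        leftIntegrand N h x (((k + 1 / 2 : ℝ) : ℂ) + ((-N * s.im : ℝ) : ℂ) * I) := by
  have h1 := left_change_of_variable hN k hs
  rw [lambertMellin_mul_cpow_eq_leftIntegrand hx hN, h1]
  · rw [h1, add_re, re_ofReal_mul, I_re, mul_zero, add_zero, ofReal_re]; exact hk
  · intro m; rw [hs]; exact leftAbscissa_ne_int hN k m

theorem exists_norm_lambertMellin_left_le {x : ℝ} (hx : 0 < x) (hN : 0 < N) (k : ℕ)
    (hk : 1 < (k + 1 / 2 : ℝ)) (hk' : 1 < (k + 1 / 2 + 2 * h - 1 : ℝ) / N) (n : ℕ) :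
    ∃ C : ℝ, ∀ s : ℂ, s.re = leftAbscissa N h k →
      ‖lambertMellin N h s * (x : ℂ) ^ (-s)‖ * (1 + |s.im|) ^ n ≤ C := by
  obtain ⟨C, hC⟩ := exists_norm_leftIntegrand_le (h := h) hN x k hk hk' n
  refine ⟨(2 * Real.pi / x) ^ (s₀ N h) * C, fun s hs => ?_⟩
  rw [lambertMellin_mul_cpow_left hx hN k hk hs, norm_mul, norm_mul, norm_zpow, norm_neg, norm_one,
    one_zpow, one_mul, norm_real, Real.norm_of_nonneg (by positivity), mul_assoc]
  have him : |s.im| ≤ |-(N : ℝ) * s.im| := by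
    rw [abs_mul, abs_neg, Nat.abs_cast]
    exact le_mul_of_one_le_left (abs_nonneg _) (by exact_mod_cast hN)
  exact mul_le_mul_of_nonneg_left ((mul_le_mul_of_nonneg_left
    (pow_le_pow_left₀ (by positivity) (add_le_add_right him 1) n) (norm_nonneg _)).trans
      (hC (-N * s.im))) (by positivity)

theorem exists_norm_lambertMellin_le {x : ℝ} (hx : 0 < x) (hN : 0 < N) (a b : ℝ) :
    ∃ A B : ℝ, ∀ s : ℂ, a ≤ s.re → s.re ≤ b → 2 ≤ |s.im| →
      ‖lambertMellin N h s * (x : ℂ) ^ (-s)‖ ≤ A * Real.exp (B * |s.im|) := by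
  obtain ⟨C₁, h1⟩ := exists_norm_Gamma_le_of_one_le_abs_im a b
  obtain ⟨C₂, h2⟩ := exists_norm_riemannZeta_le a b
  obtain ⟨C₃, h3⟩ := exists_norm_riemannZeta_le (N * a - N + 2 * h) (N * b - N + 2 * h)
  have hN' : (1 : ℝ) ≤ N := by exact_mod_cast hN
  refine ⟨C₁ * C₂ * C₃ * (x ^ (-a) + x ^ (-b)), Real.pi + Real.pi * N, fun s ha hb hs => ?_⟩
  have e1 := h1 s ha hb (by linarith)
  have e2 := h2 s ha hb hs
  have him : (N * s - N + 2 * h : ℂ).im = N * s.im := by simp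
  have hre : (N * s - N + 2 * h : ℂ).re = N * s.re - N + 2 * h := by simp
  have e3 := h3 (N * s - N + 2 * h) (by rw [hre]; gcongr) (by rw [hre]; gcongr)
    (by rw [him, abs_mul, Nat.abs_cast]; nlinarith [abs_nonneg s.im])
  rw [him, abs_mul, Nat.abs_cast] at e3
  have e4 : x ^ (-s.re) ≤ x ^ (-a) + x ^ (-b) := by
    rcases le_total 1 x with hx1 | hx1
    · refine (Real.rpow_le_rpow_of_exponent_le hx1 (neg_le_neg ha)).trans ?_
      linarith [Real.rpow_pos_of_pos hx (-b)]
    · refine (Real.rpow_le_rpow_of_exponent_ge hx hx1 (neg_le_neg hb)).trans ?_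
      linarith [Real.rpow_pos_of_pos hx (-a)]
  rw [lambertMellin, norm_mul, norm_mul, norm_mul, norm_cpow_eq_rpow_re_of_pos hx, neg_re]
  have p1 := (norm_nonneg _).trans e1
  have p2 := (norm_nonneg _).trans e2
  have p3 := (norm_nonneg _).trans e3
  calc _ ≤ C₁ * (C₂ * Real.exp (Real.pi * |s.im|)) * (C₃ * Real.exp (Real.pi * (N * |s.im|))) *
        (x ^ (-a) + x ^ (-b)) := by gcongr
    _ = C₁ * C₂ * C₃ * (x ^ (-a) + x ^ (-b)) *
        (Real.exp (Real.pi * |s.im|) * Real.exp (Real.pi * (N * |s.im|))) := by ring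
    _ = _ := by rw [← Real.exp_add]; congr 2; ring

theorem lt_of_mem_lambertPoles (hN : 0 < N) {k : ℕ}
    (hk' : 2 * (⌊(h : ℝ) / N⌋₊ : ℝ) + 1 < (k + 1 / 2 + 2 * h - 1 : ℝ) / N) {p : ℝ}
    (hp : p ∈ lambertPoles N h) : leftAbscissa N h k < p := by
  have hN' : (0 : ℝ) < N := by exact_mod_cast hN
  have hJ : (0 : ℝ) ≤ ⌊(h : ℝ) / N⌋₊ := Nat.cast_nonneg _
  have h0 : leftAbscissa N h k < -(2 * (⌊(h : ℝ) / N⌋₊ : ℝ)) := by rw [leftAbscissa]; linarith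
  rw [lambertPoles, Finset.mem_union, Finset.mem_insert, Finset.mem_insert, Finset.mem_singleton,
    Finset.mem_image] at hp
  rcases hp with (rfl | rfl | rfl) | ⟨j, hj, rfl⟩
  · linarith
  · linarith
  -- The distance from the left line to `s₀` is `(k + 1/2)/N`.
  · rw [leftAbscissa, s₀, lt_div_iff₀ hN', sub_mul, div_mul_cancel₀ _ hN'.ne']
    linarith [(Nat.cast_nonneg k : (0 : ℝ) ≤ k)]
  · have : (j : ℝ) ≤ ⌊(h : ℝ) / N⌋₊ := by exact_mod_cast (Finset.mem_Icc.1 hj).2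
    linarith

theorem mem_lambertPoles_lt (hN : 0 < N) {c : ℝ} (hc : 1 < c) (hc' : 1 < N * c - N + 2 * h) {p : ℝ}
    (hp : p ∈ lambertPoles N h) : p < c := by
  have hN' : (0 : ℝ) < N := by exact_mod_cast hN
  rw [lambertPoles, Finset.mem_union, Finset.mem_insert, Finset.mem_insert, Finset.mem_singleton,
    Finset.mem_image] at hp
  rcases hp with (rfl | rfl | rfl) | ⟨j, hj, rfl⟩
  · linarith
  · linarith
  · rw [s₀, div_lt_iff₀ hN']; linarith
  · linarith [(Nat.cast_nonneg j : (0 : ℝ) ≤ j)]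

/-- The contour shift for the Mellin representation of the generalized Lambert series. -/
theorem integral_lambertMellin_shift {x : ℝ} (hx : 0 < x) (hN : 0 < N)
    (hNh : (N : ℤ) - 2 * h ≠ -1) {k K : ℕ} (hk : 1 < (k + 1 / 2 : ℝ))
    (hk' : 1 < N * (k + 1 / 2 : ℝ) - N + 2 * h) (hK : 1 < (K + 1 / 2 : ℝ))
    (hK' : 2 * (⌊(h : ℝ) / N⌋₊ : ℝ) + 1 < (K + 1 / 2 + 2 * h - 1 : ℝ) / N) :
    (∫ t : ℝ, lambertMellin N h (((k + 1 / 2 : ℝ) : ℂ) + t * I) *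
        (x : ℂ) ^ (-(((k + 1 / 2 : ℝ) : ℂ) + t * I))) -
      ∫ t : ℝ, lambertMellin N h ((leftAbscissa N h K : ℂ) + t * I) *
        (x : ℂ) ^ (-((leftAbscissa N h K : ℂ) + t * I)) = 2 * Real.pi * P₁ x N h := by
  have hK1 : 1 < (K + 1 / 2 + 2 * h - 1 : ℝ) / N := by
    have : (0 : ℝ) ≤ ⌊(h : ℝ) / N⌋₊ := Nat.cast_nonneg _
    linarith
  have hpL : ∀ p ∈ lambertPoles N h, leftAbscissa N h K < p ∧ p < k + 1 / 2 := fun p hp =>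
    ⟨lt_of_mem_lambertPoles hN hK' hp, mem_lambertPoles_lt hN hk hk' hp⟩
  have hL0 : leftAbscissa N h K < 0 := (hpL 0 (by simp [lambertPoles])).1
  have hab : leftAbscissa N h K < k + 1 / 2 := by linarith
  have hana : ∀ s : ℂ, leftAbscissa N h K ≤ s.re → s.re ≤ (k + 1 / 2 : ℝ) →
      (s.re = leftAbscissa N h K ∨ s.re = (k + 1 / 2 : ℝ) ∨ 1 ≤ |s.im|) →
      AnalyticAt ℂ (fun s => lambertMellin N h s * (x : ℂ) ^ (-s)) s := by
    intro s _ _ hs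
    have hreal : ∀ p : ℝ, s = p → p ≠ leftAbscissa N h K → p ≠ k + 1 / 2 → False := by
      rintro p rfl h1 h2
      simp only [ofReal_re, ofReal_im, abs_zero] at hs
      rcases hs with hs | hs | hs
      · exact h1 hs
      · exact h2 hs
      · linarith
    refine (analyticAt_lambertMellin hN (fun m hm => ?_) (fun h1 => ?_) (fun h1 => ?_)).mul
      (analyticAt_ofReal_cpow_neg hx s)
    · refine hreal (-m) (by rw [hm]; simp) ?_ ?_
      · have := leftAbscissa_ne_int (h := h) hN K (-m)
        push_cast at this
        exact this.symm
      · have := (Nat.cast_nonneg m : (0 : ℝ) ≤ m)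
        exact ne_of_lt (by linarith)
    · exact hreal 1 (by rw [h1]; simp) (by linarith) (by linarith)
    · have := hpL (s₀ N h) (by simp [lambertPoles])
      exact hreal _ h1 this.1.ne' this.2.ne
  have hmero : MeromorphicOn (fun s => lambertMellin N h s * (x : ℂ) ^ (-s)) univ := fun s hs =>
    (meromorphicOn_lambertMellin s hs).mul (analyticAt_ofReal_cpow_neg hx s).meromorphicAt
  have hRQ : ∀ s : ℂ, leftAbscissa N h K ≤ s.re → s.re ≤ (k + 1 / 2 : ℝ) →
      lambertResidue N h s * (x : ℂ) ^ (-s) ≠ 0 → ∃ p ∈ lambertPoles N h, (p : ℂ) = s :=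
    fun s _ _ hs => exists_mem_lambertPoles hN hNh (left_ne_zero_of_mul hs)
  have hlim : ∀ s : ℂ, leftAbscissa N h K ≤ s.re → s.re ≤ (k + 1 / 2 : ℝ) →
      Tendsto (fun z => (z - s) * (lambertMellin N h z * (x : ℂ) ^ (-z))) (𝓝[≠] s)
        (𝓝 (lambertResidue N h s * (x : ℂ) ^ (-s))) := fun s _ _ => by
    refine ((tendsto_lambertResidue hN hNh s).mul
      ((analyticAt_ofReal_cpow_neg hx s).continuousAt.tendsto.mono_left nhdsWithin_le_nhds)).congr
      fun z => ?_
    ring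
  -- The exponent is the degree of the polynomial multiplier in the Phragmén–Lindelöf step.
  obtain ⟨CL, hCL⟩ := exists_norm_lambertMellin_left_le (h := h) hx hN K hK hK1
    ((lambertPoles N h).card + 2)
  obtain ⟨CR, hCR⟩ := exists_norm_lambertMellin_right_le (h := h) hx k hk hk'
    ((lambertPoles N h).card + 2)
  obtain ⟨C, hC⟩ := exists_norm_le_div_sq_of_edges hab hmero (lambertPoles N h) _ hRQ hlim hana
    ⟨max CL CR, by
      rintro s (hs | hs)
      · exact (hCL s hs).trans (le_max_left _ _)
      · exact (hCR s hs).trans (le_max_right _ _)⟩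
    (exists_norm_lambertMellin_le hx hN _ _)
  have hcont : ∀ c : ℝ, leftAbscissa N h K ≤ c → c ≤ k + 1 / 2 →
      (c = leftAbscissa N h K ∨ c = k + 1 / 2) → Continuous fun t : ℝ =>
        lambertMellin N h ((c : ℂ) + t * I) * (x : ℂ) ^ (-((c : ℂ) + t * I)) := by
    intro c h1 h2 h3
    refine continuous_iff_continuousAt.2 fun t => ?_
    have hre : ((c : ℂ) + t * I).re = c := by simp
    exact ContinuousAt.comp (g := fun s => lambertMellin N h s * (x : ℂ) ^ (-s))
      (f := fun t : ℝ => (c : ℂ) + t * I)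
      (hana _ (by rw [hre]; exact h1) (by rw [hre]; exact h2)
        (by rw [hre]; tauto)).continuousAt (by fun_prop)
  rw [integral_vertical_shift hab hmero (lambertPoles N h) hpL _ hRQ hlim hana hC
    (integrable_of_norm_mul_one_add_abs_pow_le (hcont _ le_rfl hab.le (Or.inl rfl))
      fun t => by simpa using hCL ((leftAbscissa N h K : ℂ) + t * I) (by simp))
    (integrable_of_norm_mul_one_add_abs_pow_le (hcont _ hab.le le_rfl (Or.inr rfl))
      fun t => by simpa using hCR (((k + 1 / 2 : ℝ) : ℂ) + t * I) (by simp)),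
    sum_lambertPoles hN hNh x hx]

theorem integral_left_eq {x : ℝ} (hx : 0 < x) (hN : 0 < N) {K : ℕ} (hK : 1 < (K + 1 / 2 : ℝ)) :
    ∫ t : ℝ, lambertMellin N h ((leftAbscissa N h K : ℂ) + t * I) *
        (x : ℂ) ^ (-((leftAbscissa N h K : ℂ) + t * I)) =
      (-1) ^ (h + 1) * (((2 * Real.pi / x) ^ (s₀ N h) : ℝ) : ℂ) / N *
        ∫ t : ℝ, leftIntegrand N h x (((K + 1 / 2 : ℝ) : ℂ) + t * I) := by
  have h1 : ∀ t : ℝ, lambertMellin N h ((leftAbscissa N h K : ℂ) + t * I) *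
        (x : ℂ) ^ (-((leftAbscissa N h K : ℂ) + t * I)) =
      (-1) ^ (h + 1) * (((2 * Real.pi / x) ^ (s₀ N h) : ℝ) : ℂ) *
        (fun t : ℝ => leftIntegrand N h x (((K + 1 / 2 : ℝ) : ℂ) + t * I)) (-N * t) := by
    intro t
    have := lambertMellin_mul_cpow_left hx hN K hK (s := (leftAbscissa N h K : ℂ) + t * I) (h := h)
      (by simp)
    simpa using this
  -- In the variable `w` the line is traversed by `t ↦ -N t`; the Jacobian is the factor `1/N` of
  -- `S`.
  rw [integral_congr_ae (Eventually.of_forall h1), integral_const_mul,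
    Measure.integral_comp_mul_left
      (fun t : ℝ => leftIntegrand N h x (((K + 1 / 2 : ℝ) : ℂ) + t * I)),
    inv_neg, abs_neg, abs_inv, Nat.abs_cast, real_smul]
  push_cast
  ring

end KTY

/-! ### Assembly. -/

theorem mainTheorem1 (N : ℕ) (hN : 0 < N) (h : ℤ) (hNh : (N : ℤ) - 2 * h ≠ -1)
    (x : ℝ) (hx : 0 < x) :
    Summable (fun n : ℕ => KTY.lambertTerm x N h (n + 1)) ∧
    Summable (fun n : ℕ => KTY.sTerm x N h (n + 1)) ∧
    Tendsto (fun z : ℂ => Complex.Gamma z * riemannZeta z) (𝓝[≠] (KTY.s₀ N h : ℂ))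
      (𝓝 (KTY.gammaZeta (KTY.s₀ N h : ℂ))) ∧
    ((∑' n : ℕ, KTY.lambertTerm x N h (n + 1) : ℝ) : ℂ) = KTY.P₁ x N h + (KTY.S x N h : ℂ) := by
  have hN' : (1 : ℝ) ≤ N := by exact_mod_cast hN
  have h2π : (2 * Real.pi : ℂ) ≠ 0 := by
    exact_mod_cast (by positivity : (2 * Real.pi : ℝ) ≠ 0)
  -- The first bound makes `ζ(s)`, and the second then makes `ζ(Ns - N + 2h)`, absolutely convergent
  -- on the right line.
  obtain ⟨k, hk⟩ := exists_nat_ge (max 1 (N + 1 - 2 * h : ℝ))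
  have hk1 : (1 : ℝ) ≤ k := (le_max_left _ _).trans hk
  have hk2 : (N + 1 - 2 * h : ℝ) ≤ k := (le_max_right _ _).trans hk
  -- Large enough to put the left line below `-2⌊h/N⌋`, past every pole, and to make the Dirichlet
  -- series for `ζ(w)` and `ζ(1 - s)` converge there.
  obtain ⟨K, hK⟩ := exists_nat_ge (max 1 ((2 * (⌊(h : ℝ) / N⌋₊ : ℝ) + 1) * N + 1 - 2 * h))
  have hK1 : (1 : ℝ) ≤ K := (le_max_left _ _).trans hK
  have hK2 : (2 * (⌊(h : ℝ) / N⌋₊ : ℝ) + 1) * N + 1 - 2 * h ≤ K := (le_max_right _ _).trans hK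
  have hk' : 1 < N * (k + 1 / 2 : ℝ) - N + 2 * h := by nlinarith
  have hK' : 2 * (⌊(h : ℝ) / N⌋₊ : ℝ) + 1 < (K + 1 / 2 + 2 * h - 1 : ℝ) / N := by
    rw [lt_div_iff₀ (by linarith)]; linarith
  have hK'' : 1 < (K + 1 / 2 + 2 * h - 1 : ℝ) / N := by
    have : (0 : ℝ) ≤ ⌊(h : ℝ) / N⌋₊ := Nat.cast_nonneg _
    linarith
  have hL := KTY.hasSum_lambertTerm (N := N) (h := h) hx k (by linarith) hk'
  have hS := KTY.hasSum_sTerm (N := N) (h := h) hx hN K (by linarith) hK''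
  -- Over `ℝ` summability is absolute convergence, so the termwise inversion already contains it.
  have hLs : Summable fun n : ℕ => KTY.lambertTerm x N h (n + 1) := by
    rw [← Complex.summable_ofReal]
    exact (summable_mul_left_iff h2π).1 hL.summable
  have hSs : Summable fun n : ℕ => KTY.sTerm x N h (n + 1) := by
    rw [← Complex.summable_ofReal]
    exact (summable_mul_left_iff h2π).1 hS.summable
  refine ⟨hLs, hSs, KTY.tendsto_gammaZeta_s₀ hN hNh, ?_⟩
  have hL' := hL.tsum_eq
  have hS' := hS.tsum_eq
  rw [tsum_mul_left, ← Complex.ofReal_tsum] at hL' hS'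
  have hshift := KTY.integral_lambertMellin_shift hx hN hNh (by linarith) hk' (by linarith) hK'
  rw [KTY.integral_left_eq hx hN (by linarith), ← hL', ← hS', sub_eq_iff_eq_add] at hshift
  apply mul_left_cancel₀ h2π
  rw [hshift, KTY.S]
  push_cast
  ring
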